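/- Let $S$ be an additive sub-semigroup of $[0,\infty)$ such that $\mathbb{N}=\{0,1,2,\dots\}\subset S$, and let $c>0$ be a constant with $\#(S\cap[n,n+1))\le c^{\,n+1}$ for all $n\in\mathbb{N}$. A probability measure $\mu$ on $\mathbb{R}$ is said to belong to $\mathcal{P}_S$ if there exist complex numbers $(a_\beta)_{\beta\in S,\,\beta>0}$ and real numbers $r,R>0$ such that $$\mu|_{\{|x|\ge R\}}(dx)=\sum_{\beta\in S,\,\beta>0}\operatorname{Im}\!\left(a_\beta\left(\tfrac1x\right)^{\beta+1}\right)dx,\qquad |a_\beta|\le r^\beta\ \ (\beta\in S,\ \beta>0),\qquad r<c^{-1}R,$$ where $\left(\tfrac1x\right)^{\beta+1}$ is understood as $e^{i(\beta+1)\pi}|x|^{-\beta-1}$ for $x<0$ (the series converges absolutely for $|x|\ge R$). **Theorem 2.3.** Let $\mu$ be a probability measure on $\mathbb{R}$ with Fourier transform $\mathcal{F}_\mu(z)=\int_{\mathbb{R}}e^{ixz}\,\mu(dx)$. Then $\mu\in\mathcal{P}_S$ if and only if there exist $(c_\gamma)_{\gamma\in S}\subset\mathbb{C}$ and $A>0$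 such that 1. $|c_\gamma|\le A^\gamma$ for every $\gamma\in S$ with $\gamma>0$, and $c_0=1$; 2. for every $z>0$, $$\mathcal{F}_\mu(z)=\sum_{\gamma\in S}\frac{c_\gamma}{\Gamma(\gamma+1)}\,i^\gamma z^\gamma ,$$ the series being (absolutely) convergent, where $i^\gamma=e^{i\pi\gamma/2}$. -/

import Mathlib

open MeasureTheory

noncomputable section

/-- `S` is an additive sub-semigroup of `[0, ∞)` containing all natural numbers (with `0`), and
`c > 0` is a constant such that `S ∩ [n, n + 1)` has at most `c ^ (n + 1)` elements for every
natural number `n`. -/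
structure IsExponentSet (S : AddSubsemigroup ℝ) (c : ℝ) : Prop where
  nonneg : ∀ s ∈ S, 0 ≤ s
  natCast_mem : ∀ n : ℕ, (n : ℝ) ∈ S
  const_pos : 0 < c
  finite_inter : ∀ n : ℕ, ((S : Set ℝ) ∩ Set.Ico (n : ℝ) (n + 1)).Finite
  ncard_inter_le : ∀ n : ℕ,
    (((S : Set ℝ) ∩ Set.Ico (n : ℝ) (n + 1)).ncard : ℝ) ≤ c ^ (n + 1)

/-- The power `(1 / x) ^ s` of a real number `x ≠ 0`: it is `x ^ (-s)` for `x > 0`, and it is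
understood as `exp (i s π) |x| ^ (-s)` for `x < 0`. -/
def invPow (x s : ℝ) : ℂ :=
  if 0 < x then ((x ^ (-s) : ℝ) : ℂ)
  else Complex.exp (Complex.I * s * Real.pi) * ((|x| ^ (-s) : ℝ) : ℂ)

/-- The series `∑_{β ∈ S, β > 0} Im (a_β (1 / x) ^ (β + 1))`. Only the values of `a` at the positive
elements of `S` matter. -/
def tailDensity (S : AddSubsemigroup ℝ) (a : ℝ → ℂ) (x : ℝ) : ℝ :=
  ∑' β : {β : ℝ // β ∈ S ∧ 0 < β}, (a β * invPow x (β + 1)).im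

/-- The class of measures whose restriction to `{|x| ≥ R}` is the series
`∑_{β ∈ S, β > 0} Im (a_β (1 / x) ^ (β + 1)) dx`, for some `r, R > 0` and coefficients with
`|a_β| ≤ r ^ β` and `r < c⁻¹ R`; these two bounds make the series absolutely convergent on
`{|x| ≥ R}`. As `ENNReal.ofReal` truncates negative values, the non-negativity of the density
is part of the condition. -/
def MemPS (S : AddSubsemigroup ℝ) (c : ℝ) (μ : Measure ℝ) : Prop :=
  ∃ (a : ℝ → ℂ) (r R : ℝ), 0 < r ∧ 0 < R ∧
    (∀ β ∈ S, 0 < β → ‖a β‖ ≤ r ^ β) ∧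
    r < c⁻¹ * R ∧
    (∀ᵐ x ∂(volume.restrict {x : ℝ | R ≤ |x|}), 0 ≤ tailDensity S a x) ∧
    μ.restrict {x : ℝ | R ≤ |x|} =
      (volume.restrict {x : ℝ | R ≤ |x|}).withDensity
        (fun x => ENNReal.ofReal (tailDensity S a x))

end

/-! An exponent γ in the Fourier series corresponds to a power of order γ + 1 in the tail; the two
directions make this correspondence precise by different means.

From the series to the tail: integrating the conjugate of the characteristic function against
e^{-yz} cancels the Gamma factors, so for y > cA the Cauchy transform at w = iy equals ∑ conj(c_γ)
w^{-γ-1} (`cauchyTransform_mul_I`). Both sides are holomorphic in log w, which extends the identity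
to all w in the upper half-plane with |w| > R (`cauchyTransform_exp_eq_logSeries`). The series is
continuous up to the real axis, so Stieltjes inversion (`tendsto_integral_mul_im_cauchyTransform`)
gives the density -Im/π of its boundary values. The γ = 0 term is 1/x, which is real and drops out
(`memPS_of_hasSum_charFun`).

From the tail to the series: the mass in |x| < R contributes an entire function of z. For a single
tail term with coefficient a, rotating the half-lines of integration leaves, up to entire functions
and a phase, -a sin(πβ) ∫_R^∞ e^{-zx} x^{-β-1} dx. This incomplete Gamma integral is Γ(-β) z^β minus
a power series, and the reflection formula gives sin(πβ) Γ(-β) = -π/Γ(β+1). The sine also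
compensates the denominators n - β of the power series, so its bounds are uniform in β
(`exists_hasSum_fourier_im_invPow`). The sums over β and n can then be exchanged
(`hasSum_swap_entire`), and all entire parts land on the exponents in ℕ ⊂ S
(`MemPS.exists_hasSum_charFun`). Letting z tend to 0 gives c_0 = 1. -/

open MeasureTheory

/-! ### Counting exponents and summability over S. -/

namespace IsExponentSet

variable {S : AddSubsemigroup ℝ} {c : ℝ}

lemma one_le_const (hS : IsExponentSet S c) : 1 ≤ c := by
  have h := hS.ncard_inter_le 0
  have h1 : 1 ≤ ((S : Set ℝ) ∩ Set.Ico ((0 : ℕ) : ℝ) ((0 : ℕ) + 1)).ncard := by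
    rw [Nat.succ_le_iff, Set.ncard_pos (hS.finite_inter 0)]
    exact ⟨((0 : ℕ) : ℝ), hS.natCast_mem 0, by simp⟩
  have h2 : (1 : ℝ) ≤ (((S : Set ℝ) ∩ Set.Ico ((0 : ℕ) : ℝ) ((0 : ℕ) + 1)).ncard : ℝ) := by
    exact_mod_cast h1
  simpa using h2.trans h

lemma countable (hS : IsExponentSet S c) : Countable S := by
  have h : (S : Set ℝ) ⊆ ⋃ n : ℕ, ((S : Set ℝ) ∩ Set.Ico (n : ℝ) (n + 1)) := by
    intro s hs
    rw [Set.mem_iUnion]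
    exact ⟨⌊s⌋₊, hs, Nat.floor_le (hS.nonneg s hs), Nat.lt_floor_add_one s⟩
  exact ((Set.countable_iUnion fun n => (hS.finite_inter n).countable).mono h).to_subtype

/-- Group the exponents by integer part n: there are at most c^(n+1) of them, each contributing at
most q^n because c ≥ 1 forces q ≤ 1. A geometric series of ratio cq dominates. -/
lemma summable_rpow (hS : IsExponentSet S c) {q : ℝ} (hq : 0 < q) (hqc : c * q < 1) :
    Summable fun β : S => q ^ (β : ℝ) := by
  have hq1 : q ≤ 1 := by nlinarith [hS.one_le_const]
  have hcq : 0 ≤ c * q := (mul_pos hS.const_pos hq).le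
  have hg : Summable fun n : ℕ => c * (c * q) ^ n :=
    (summable_geometric_of_lt_one hcq hqc).mul_left c
  refine summable_of_sum_le (c := ∑' n : ℕ, c * (c * q) ^ n) (fun β => by positivity) fun u => ?_
  classical
  rw [← Finset.sum_fiberwise_of_maps_to (g := fun β : S => ⌊(β : ℝ)⌋₊)
    (fun β hβ => Finset.mem_image_of_mem (fun β : S => ⌊(β : ℝ)⌋₊) hβ)]
  refine (Finset.sum_le_sum fun n _ => ?_).trans
    (hg.sum_le_tsum _ fun n _ => mul_nonneg hS.const_pos.le (pow_nonneg hcq n))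
  have hcard : ((u.filter fun β : S => ⌊(β : ℝ)⌋₊ = n).card : ℝ) ≤ c ^ (n + 1) := by
    refine le_trans ?_ (hS.ncard_inter_le n)
    rw [← Finset.card_map (Function.Embedding.subtype _), ← Set.ncard_coe_finset]
    refine Nat.cast_le.2 (Set.ncard_le_ncard ?_ (hS.finite_inter n))
    intro s hs
    simp only [Finset.coe_map, Set.mem_image, Finset.mem_coe, Finset.mem_filter] at hs
    obtain ⟨β, ⟨-, hβ⟩, rfl⟩ := hs
    refine ⟨β.2, ?_⟩
    subst hβ
    exact ⟨Nat.floor_le (hS.nonneg β β.2), Nat.lt_floor_add_one _⟩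
  calc ∑ β ∈ u.filter fun β : S => ⌊(β : ℝ)⌋₊ = n, q ^ (β : ℝ)
      ≤ ∑ β ∈ u.filter fun β : S => ⌊(β : ℝ)⌋₊ = n, q ^ n := by
        refine Finset.sum_le_sum fun β hβ => ?_
        rw [← Real.rpow_natCast]
        refine Real.rpow_le_rpow_of_exponent_ge hq hq1 ?_
        rw [← (Finset.mem_filter.1 hβ).2]
        exact Nat.floor_le (hS.nonneg β β.2)
    _ ≤ c ^ (n + 1) * q ^ n := by
        rw [Finset.sum_const, nsmul_eq_mul]
        gcongr
    _ = c * (c * q) ^ n := by ring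

lemma exists_pos_le (hS : IsExponentSet S c) : ∃ δ : ℝ, 0 < δ ∧ δ ≤ 1 ∧ ∀ γ ∈ S, 0 < γ → δ ≤ γ := by
  -- Adjoining 1 makes the finite set nonempty even when S has no element in (0, 1).
  have hfin : ({1} ∪ (((S : Set ℝ) ∩ Set.Ico ((0 : ℕ) : ℝ) ((0 : ℕ) + 1)) ∩ Set.Ioi 0)).Finite :=
    (Set.finite_singleton 1).union ((hS.finite_inter 0).inter_of_left _)
  obtain ⟨δ, hδ, hmin⟩ := hfin.exists_minimalFor id _ ⟨1, by simp⟩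
  have hmin' : ∀ x ∈ ({1} ∪ (((S : Set ℝ) ∩ Set.Ico ((0 : ℕ) : ℝ) ((0 : ℕ) + 1)) ∩ Set.Ioi 0)),
      δ ≤ x := fun x hx => (le_total δ x).elim id fun h => hmin hx h
  have h1 : δ ≤ 1 := hmin' 1 (by simp)
  refine ⟨δ, ?_, h1, fun γ hγ h0 => ?_⟩
  · rcases hδ with h | h
    · rw [Set.mem_singleton_iff] at h
      simp [h]
    · exact h.2
  · rcases lt_or_ge γ 1 with h | h
    · exact hmin' γ (Or.inr ⟨⟨hγ, by simpa using h0.le, by simpa using h⟩, h0⟩)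
    · exact h1.trans h

/-- Multiplicative constants can be absorbed into the base: positive exponents are at least δ, so K
≤ max(K,1)^(γ/δ). -/
lemma exists_mul_rpow_le (hS : IsExponentSet S c) (K B : ℝ) (hB : 0 < B) :
    ∃ A : ℝ, 0 < A ∧ ∀ γ ∈ S, 0 < γ → K * B ^ γ ≤ A ^ γ := by
  obtain ⟨δ, hδ, -, hmin⟩ := hS.exists_pos_le
  have hK : 1 ≤ max K 1 := le_max_right _ _
  refine ⟨(max K 1) ^ (1 / δ) * B, by positivity, fun γ hγ h0 => ?_⟩
  rw [Real.mul_rpow (by positivity) hB.le, ← Real.rpow_mul (by positivity)]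
  gcongr
  calc K ≤ max K 1 := le_max_left _ _
    _ = max K 1 ^ (1 : ℝ) := (Real.rpow_one _).symm
    _ ≤ _ := Real.rpow_le_rpow_of_exponent_le hK (by
        rw [one_div_mul_eq_div, one_le_div hδ]; exact hmin γ hγ h0)

end IsExponentSet

namespace IsExponentSet

variable {S : AddSubsemigroup ℝ} {c : ℝ}

lemma hasSum_pos_iff (hS : IsExponentSet S c) {E : Type*} [AddCommMonoid E] [TopologicalSpace E]
    {f : ℝ → E} (hf : f 0 = 0) {s : E} :
    HasSum (fun β : {β : ℝ // β ∈ S ∧ 0 < β} => f β) s ↔ HasSum (fun γ : S => f γ) s := by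
  let i : {β : ℝ // β ∈ S ∧ 0 < β} → S := fun β => ⟨β, β.2.1⟩
  have hi : Function.Injective i := fun x y h => Subtype.ext (congrArg (fun z : S => (z : ℝ)) h)
  refine hi.hasSum_iff (f := fun γ : S => f γ) fun γ hγ => ?_
  have h0 : (γ : ℝ) = 0 := by
    by_contra h
    exact hγ ⟨⟨γ, γ.2, (hS.nonneg γ γ.2).lt_of_ne' h⟩, rfl⟩
  simp [h0, hf]

lemma summable_pos_rpow (hS : IsExponentSet S c) {q : ℝ} (hq : 0 < q) (hqc : c * q < 1) :
    Summable fun β : {β : ℝ // β ∈ S ∧ 0 < β} => q ^ (β : ℝ) :=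
  (hS.summable_rpow hq hqc).comp_injective (i := fun β : {β : ℝ // β ∈ S ∧ 0 < β} =>
    (⟨β, β.2.1⟩ : S)) fun _ _ h => Subtype.ext (congrArg (fun z : S => (z : ℝ)) h)

lemma countable_pos (hS : IsExponentSet S c) : Countable {β : ℝ // β ∈ S ∧ 0 < β} :=
  have := hS.countable
  Function.Injective.countable (f := fun β : {β : ℝ // β ∈ S ∧ 0 < β} => (⟨β, β.2.1⟩ : S))
    fun _ _ h => Subtype.ext (congrArg (fun z : S => (z : ℝ)) h)

end IsExponentSet

/-! ### Powers of 1/x and bounds for the tail density. -/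

lemma norm_invPow (x s : ℝ) : ‖invPow x s‖ = |x| ^ (-s) := by
  unfold invPow
  split_ifs with h
  · rw [Complex.norm_real, Real.norm_of_nonneg (by positivity), abs_of_pos h]
  · rw [norm_mul, show Complex.I * s * Real.pi = ((s * Real.pi : ℝ) : ℂ) * Complex.I by
      push_cast; ring, Complex.norm_exp_ofReal_mul_I, Complex.norm_real,
      Real.norm_of_nonneg (by positivity), one_mul]

/-- The principal logarithm has argument +π at negative x, whereas the convention for (1/x)^s has
phase e^{+isπ}; hence the conjugate, and the conjugated coefficients in `logSeries`. -/
lemma invPow_eq_conj_exp {x : ℝ} (hx : x ≠ 0) (s : ℝ) :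
    invPow x s = (starRingEnd ℂ) (Complex.exp (-s * Complex.log x)) := by
  have habs : (0 : ℝ) < |x| := abs_pos.2 hx
  rw [← Complex.exp_conj, map_mul]
  unfold invPow
  split_ifs with h
  · rw [← Complex.ofReal_log h.le, Real.rpow_def_of_pos h, Complex.ofReal_exp]
    simp only [map_neg, Complex.conj_ofReal]
    push_cast; ring_nf
  · have hneg : x < 0 := lt_of_le_of_ne (not_lt.1 h) hx
    rw [Complex.log, Complex.arg_ofReal_of_neg hneg, Complex.norm_real, Real.norm_eq_abs,
      Real.rpow_def_of_pos habs, Complex.ofReal_exp, ← Complex.exp_add]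
    simp only [map_neg, map_add, map_mul, Complex.conj_ofReal, Complex.conj_I]
    push_cast; ring_nf

lemma continuousAt_invPow {x : ℝ} (hx : x ≠ 0) (s : ℝ) :
    ContinuousAt (fun x => invPow x s) x := by
  rcases hx.lt_or_gt with h | h
  · have : (fun x : ℝ => Complex.exp (Complex.I * s * Real.pi) * ((|x| ^ (-s) : ℝ) : ℂ))
        =ᶠ[nhds x] fun x => invPow x s := by
      filter_upwards [Iio_mem_nhds h] with y hy
      rw [invPow, if_neg (not_lt.2 (le_of_lt hy))]
    refine ContinuousAt.congr ?_ this
    exact continuousAt_const.mul (Complex.continuous_ofReal.continuousAt.comp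
      (continuous_abs.continuousAt.rpow_const (Or.inl (abs_pos.2 hx).ne')))
  · have : (fun x : ℝ => ((x ^ (-s) : ℝ) : ℂ)) =ᶠ[nhds x] fun x => invPow x s := by
      filter_upwards [Ioi_mem_nhds h] with y hy
      rw [invPow, if_pos (Set.mem_Ioi.1 hy)]
    refine ContinuousAt.congr ?_ this
    exact Complex.continuous_ofReal.continuousAt.comp
      (continuousAt_id.rpow_const (Or.inl hx))

lemma measurableSet_le_abs (R : ℝ) : MeasurableSet {x : ℝ | R ≤ |x|} :=
  measurableSet_le measurable_const continuous_abs.measurable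

lemma norm_mul_invPow_le {a : ℂ} {r R β x : ℝ} (hr : 0 ≤ r) (hR : 0 < R) (hβ : 0 ≤ β)
    (ha : ‖a‖ ≤ r ^ β) (hx : R ≤ |x|) : ‖a * invPow x (β + 1)‖ ≤ R⁻¹ * (r / R) ^ β := by
  have hx0 : 0 < |x| := hR.trans_le hx
  rw [norm_mul, norm_invPow, Real.rpow_neg hx0.le, Real.rpow_add_one hx0.ne',
    Real.div_rpow hr hR.le, mul_inv]
  calc ‖a‖ * ((|x| ^ β)⁻¹ * |x|⁻¹) ≤ r ^ β * ((R ^ β)⁻¹ * R⁻¹) := by gcongr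
    _ = R⁻¹ * (r ^ β / R ^ β) := by ring

section tail

variable {S : AddSubsemigroup ℝ} {c : ℝ} {a : ℝ → ℂ} {r R : ℝ}

lemma continuousOn_tailDensity (hS : IsExponentSet S c) (hr : 0 < r) (hR : 0 < R)
    (hrR : c * (r / R) < 1) (ha : ∀ β ∈ S, 0 < β → ‖a β‖ ≤ r ^ β) :
    ContinuousOn (tailDensity S a) {x | R ≤ |x|} := by
  refine continuousOn_tsum (fun β x hx => ?_)
    ((hS.summable_pos_rpow (div_pos hr hR) hrR).mul_left R⁻¹) fun β x hx => ?_
  · have hx0 : x ≠ 0 := abs_pos.1 (hR.trans_le hx)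
    exact (Complex.continuous_im.continuousAt.comp
      (continuousAt_const.mul (continuousAt_invPow hx0 _))).continuousWithinAt
  · exact (Complex.abs_im_le_norm _).trans
      (norm_mul_invPow_le hr.le hR β.2.2.le (ha β β.2.1 β.2.2) hx)

lemma abs_tailDensity_le (hS : IsExponentSet S c) (hr : 0 < r) (hR : 0 < R)
    (hrR : c * (r / R) < 1) (ha : ∀ β ∈ S, 0 < β → ‖a β‖ ≤ r ^ β) {x : ℝ} (hx : R ≤ |x|) :
    |tailDensity S a x| ≤
      ∑' β : {β : ℝ // β ∈ S ∧ 0 < β}, R⁻¹ * (r / R) ^ (β : ℝ) :=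
  tsum_of_norm_bounded (f := fun β : {β : ℝ // β ∈ S ∧ 0 < β} => (a β * invPow x (β + 1)).im)
    ((hS.summable_pos_rpow (div_pos hr hR) hrR).mul_left R⁻¹).hasSum fun β => (Complex.abs_im_le_norm _).trans
      (norm_mul_invPow_le hr.le hR β.2.2.le (ha β β.2.1 β.2.2) hx)

end tail

/-! ### The Cauchy transform as a series, by Laplace transform and analytic continuation. -/

/-- The Cauchy transform of a measure on the real line. -/
noncomputable def cauchyTransform (μ : Measure ℝ) (w : ℂ) : ℂ := ∫ x : ℝ, (w - x)⁻¹ ∂μ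

/-- The series `∑ conj (m γ) w ^ (-γ - 1)` in the logarithmic coordinate `ζ = log w`. -/
noncomputable def logSeries (S : AddSubsemigroup ℝ) (m : ℝ → ℂ) (ζ : ℂ) : ℂ :=
  ∑' γ : S, (starRingEnd ℂ) (m γ) * Complex.exp (-((γ : ℝ) + 1) * ζ)

lemma differentiableAt_cauchyTransform (μ : Measure ℝ) [IsFiniteMeasure μ] {w : ℂ}
    (hw : w.im ≠ 0) : DifferentiableAt ℂ (cauchyTransform μ) w := by
  have h : cauchyTransform μ = fun w : ℂ => -resolventTransform μ w := by
    funext w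
    rw [cauchyTransform, resolventTransform_apply, ← integral_neg]
    refine integral_congr_ae (Filter.Eventually.of_forall fun x => ?_)
    simp only [resolvent, Ring.inverse_eq_inv']
    rw [← inv_neg, neg_sub]
    rfl
  rw [h]
  refine (hasDerivAt_resolventTransform w ?_).differentiableAt.neg
  rintro ⟨x, -, rfl⟩
  exact hw (by simp)

lemma integral_exp_mul_conj_charFun (μ : Measure ℝ) [IsFiniteMeasure μ] {y : ℝ} (hy : 0 < y) :
    ∫ z in Set.Ioi (0 : ℝ), (Real.exp (-y * z) : ℂ) * (starRingEnd ℂ) (charFun μ z) =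
      ∫ x : ℝ, ((y : ℂ) + x * Complex.I)⁻¹ ∂μ := by
  have h1 : ∀ z : ℝ, (Real.exp (-y * z) : ℂ) * (starRingEnd ℂ) (charFun μ z) =
      ∫ x : ℝ, Complex.exp (-((y : ℂ) + x * Complex.I) * z) ∂μ := by
    intro z
    rw [← charFun_neg, charFun_apply_real, ← integral_const_mul]
    refine integral_congr_ae (Filter.Eventually.of_forall fun x => ?_)
    simp only
    rw [Complex.ofReal_exp, ← Complex.exp_add]
    push_cast; ring_nf
  simp_rw [h1]
  rw [integral_integral_swap]
  · refine integral_congr_ae (Filter.Eventually.of_forall fun x => ?_)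
    simp only
    rw [integral_exp_mul_complex_Ioi (by simpa using hy)]
    simp [div_eq_mul_inv, neg_inv]
  · have hint : Integrable (fun p : ℝ × ℝ => Real.exp (-y * p.1))
        ((volume.restrict (Set.Ioi 0)).prod μ) := Integrable.comp_fst (exp_neg_integrableOn_Ioi 0 hy) μ
    refine hint.mono' (by unfold Function.uncurry; fun_prop) (Filter.Eventually.of_forall fun p => ?_)
    simp [Function.uncurry, Complex.norm_exp]

section series

variable {S : AddSubsemigroup ℝ} {c : ℝ} {m : ℝ → ℂ} {A : ℝ}

lemma norm_logSeries_term_le {R : ℝ} (hA : 0 < A) (hR : 0 < R) (hm : ∀ γ ∈ S, ‖m γ‖ ≤ A ^ γ)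
    {γ : ℝ} (hγ : γ ∈ S) (h0 : 0 ≤ γ) {ζ : ℂ} (hζ : Real.log R ≤ ζ.re) :
    ‖(starRingEnd ℂ) (m γ) * Complex.exp (-((γ : ℝ) + 1) * ζ)‖ ≤ R⁻¹ * (A / R) ^ γ := by
  have h1 : ‖Complex.exp (-((γ : ℝ) + 1) * ζ)‖ ≤ R ^ (-(γ + 1)) := by
    rw [Complex.norm_exp, Real.rpow_def_of_pos hR, Real.exp_le_exp]
    simp only [Complex.mul_re, Complex.neg_re, Complex.add_re, Complex.ofReal_re, Complex.one_re,
      Complex.neg_im, Complex.add_im, Complex.ofReal_im, Complex.one_im, add_zero, neg_zero,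
      zero_mul, sub_zero]
    nlinarith
  rw [norm_mul, RCLike.norm_conj]
  calc ‖m γ‖ * ‖Complex.exp (-((γ : ℝ) + 1) * ζ)‖ ≤ A ^ γ * R ^ (-(γ + 1)) := by
        gcongr
        exact hm γ hγ
    _ = R⁻¹ * (A / R) ^ γ := by
        rw [Real.rpow_neg hR.le, Real.rpow_add_one hR.ne', Real.div_rpow hA.le hR.le, mul_inv]
        ring

lemma summable_logSeries_bound (hS : IsExponentSet S c) {R : ℝ} (hA : 0 < A) (hR : 0 < R)
    (hAR : c * (A / R) < 1) : Summable fun γ : S => R⁻¹ * (A / R) ^ (γ : ℝ) :=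
  (hS.summable_rpow (div_pos hA hR) hAR).mul_left R⁻¹

lemma differentiableOn_logSeries (hS : IsExponentSet S c) {R : ℝ} (hA : 0 < A) (hR : 0 < R)
    (hAR : c * (A / R) < 1) (hm : ∀ γ ∈ S, ‖m γ‖ ≤ A ^ γ) {U : Set ℂ} (hU : IsOpen U)
    (hUR : ∀ ζ ∈ U, Real.log R ≤ ζ.re) : DifferentiableOn ℂ (logSeries S m) U :=
  Complex.differentiableOn_tsum_of_summable_norm (summable_logSeries_bound hS hA hR hAR)
    (fun γ => by fun_prop) hU
    fun γ ζ hζ => norm_logSeries_term_le hA hR hm γ.2 (hS.nonneg γ γ.2) (hUR ζ hζ)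

lemma continuousOn_logSeries (hS : IsExponentSet S c) {R : ℝ} (hA : 0 < A) (hR : 0 < R)
    (hAR : c * (A / R) < 1) (hm : ∀ γ ∈ S, ‖m γ‖ ≤ A ^ γ) :
    ContinuousOn (logSeries S m) {ζ | Real.log R ≤ ζ.re} :=
  continuousOn_tsum (fun γ => by fun_prop) (summable_logSeries_bound hS hA hR hAR)
    fun γ _ hζ => norm_logSeries_term_le hA hR hm γ.2 (hS.nonneg γ γ.2) hζ

lemma norm_logSeries_le (hS : IsExponentSet S c) {R : ℝ} (hA : 0 < A) (hR : 0 < R)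
    (hAR : c * (A / R) < 1) (hm : ∀ γ ∈ S, ‖m γ‖ ≤ A ^ γ) {ζ : ℂ} (hζ : Real.log R ≤ ζ.re) :
    ‖logSeries S m ζ‖ ≤ ∑' γ : S, R⁻¹ * (A / R) ^ (γ : ℝ) :=
  tsum_of_norm_bounded (summable_logSeries_bound hS hA hR hAR).hasSum
    fun γ => norm_logSeries_term_le hA hR hm γ.2 (hS.nonneg γ γ.2) hζ

lemma cauchyTransform_mul_I (hS : IsExponentSet S c) {μ : Measure ℝ} [IsFiniteMeasure μ]
    (hA : 0 < A) (hm : ∀ γ ∈ S, ‖m γ‖ ≤ A ^ γ)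
    (hF : ∀ z : ℝ, 0 < z → HasSum
      (fun γ : S => m γ / (Real.Gamma (γ + 1) : ℂ) * Complex.I ^ ((γ : ℝ) : ℂ) *
        (z : ℂ) ^ ((γ : ℝ) : ℂ)) (charFun μ z))
    {y : ℝ} (hy : c * A < y) :
    cauchyTransform μ (y * Complex.I) = logSeries S m (Real.log y + Real.pi / 2 * Complex.I) := by
  have := hS.countable
  have hy0 : 0 < y := (mul_pos hS.const_pos hA).trans hy
  have hAy : c * (A / y) < 1 := by rwa [← mul_div_assoc, div_lt_one hy0]
  set f : S → ℝ → ℂ := fun γ z => ((starRingEnd ℂ) (m γ) * Complex.exp (-((γ : ℝ) * (Real.pi / 2)) *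
    Complex.I) / (Real.Gamma (γ + 1) : ℂ)) * ((z ^ ((γ + 1 : ℝ) - 1) * Real.exp (-(y * z)) : ℝ) : ℂ)
    with hf
  have hpos : ∀ γ : S, (0 : ℝ) < γ + 1 := fun γ => by linarith [hS.nonneg γ γ.2]
  have hg : ∀ γ : S, IntegrableOn (fun z : ℝ => z ^ ((γ + 1 : ℝ) - 1) * Real.exp (-(y * z)))
      (Set.Ioi 0) := fun γ => by
    -- Integrability comes from the value: a non-integrable function has integral 0 by convention,
    -- but the Gamma formula gives a positive number.
    by_contra h
    have h1 := Real.integral_rpow_mul_exp_neg_mul_Ioi (hpos γ) hy0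
    rw [integral_undef h] at h1
    have := Real.Gamma_pos_of_pos (hpos γ)
    have h2 : 0 < (1 / y) ^ ((γ : ℝ) + 1) := by positivity
    nlinarith [mul_pos h2 this]
  have hfint : ∀ γ : S, Integrable (f γ) (volume.restrict (Set.Ioi 0)) := fun γ =>
    ((hg γ).ofReal (𝕜 := ℂ)).const_mul _
  have hval : ∀ γ : S, ∫ z in Set.Ioi (0 : ℝ), f γ z = Complex.I * ((starRingEnd ℂ) (m γ) *
      Complex.exp (-((γ : ℝ) + 1) * (Real.log y + Real.pi / 2 * Complex.I))) := fun γ => by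
    have hG : (Real.Gamma (γ + 1) : ℂ) ≠ 0 := by
      exact_mod_cast (Real.Gamma_pos_of_pos (hpos γ)).ne'
    simp only [hf]
    rw [integral_const_mul, integral_complex_ofReal, Real.integral_rpow_mul_exp_neg_mul_Ioi (hpos γ) hy0]
    have hI : Complex.exp (-(Real.pi / 2 * Complex.I)) = -Complex.I := by
      rw [Complex.exp_neg, Complex.exp_pi_div_two_mul_I, Complex.inv_I]
    rw [Real.rpow_def_of_pos (by positivity), one_div, Real.log_inv,
      show -(((γ : ℝ) : ℂ) + 1) * (Real.log y + Real.pi / 2 * Complex.I) =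
        ((-Real.log y * ((γ : ℝ) + 1) : ℝ) : ℂ) + -((γ : ℝ) * (Real.pi / 2)) * Complex.I +
          -(Real.pi / 2 * Complex.I) by push_cast; ring, Complex.exp_add, Complex.exp_add, hI]
    push_cast
    field_simp
    rw [Complex.I_sq]; ring
  -- The Gamma factor cancels in absolute value too, leaving a bound summable exactly when cA < y;
  -- this licenses termwise integration.
  have hnorm : ∀ γ : S, ∫ z in Set.Ioi (0 : ℝ), ‖f γ z‖ ≤ y⁻¹ * (A / y) ^ (γ : ℝ) := fun γ => by
    have hG := Real.Gamma_pos_of_pos (hpos γ)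
    have h1 : ∀ z ∈ Set.Ioi (0 : ℝ), ‖f γ z‖ =
        (‖m γ‖ / Real.Gamma (γ + 1)) * (z ^ ((γ + 1 : ℝ) - 1) * Real.exp (-(y * z))) := by
      intro z hz
      have hz0 : (0 : ℝ) < z := hz
      simp only [hf]
      rw [norm_mul, norm_div, norm_mul, RCLike.norm_conj, Complex.norm_real, Complex.norm_real,
        Real.norm_of_nonneg hG.le, Real.norm_of_nonneg (by positivity),
        show -(((γ : ℝ) : ℂ) * (Real.pi / 2)) * Complex.I =
          ((-((γ : ℝ) * (Real.pi / 2)) : ℝ) : ℂ) * Complex.I by push_cast; ring,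
        Complex.norm_exp_ofReal_mul_I, mul_one]
    rw [setIntegral_congr_fun measurableSet_Ioi h1, integral_const_mul,
      Real.integral_rpow_mul_exp_neg_mul_Ioi (hpos γ) hy0, one_div, Real.inv_rpow hy0.le,
      Real.rpow_add_one hy0.ne', Real.div_rpow hA.le hy0.le]
    have := hm γ γ.2
    calc ‖m γ‖ / Real.Gamma (γ + 1) * ((y ^ (γ : ℝ) * y)⁻¹ * Real.Gamma (γ + 1))
        = ‖m γ‖ * (y ^ (γ : ℝ) * y)⁻¹ := by field_simp
      _ ≤ A ^ (γ : ℝ) * (y ^ (γ : ℝ) * y)⁻¹ := by gcongr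
      _ = _ := by rw [mul_inv]; ring
  have hsum := hasSum_integral_of_summable_integral_norm hfint
    (Summable.of_nonneg_of_le (fun γ => integral_nonneg fun z => norm_nonneg _) hnorm
      (summable_logSeries_bound hS hA hy0 hAy))
  simp_rw [hval] at hsum
  have hconj : ∀ z ∈ Set.Ioi (0 : ℝ), ∑' γ : S, f γ z =
      (Real.exp (-y * z) : ℂ) * (starRingEnd ℂ) (charFun μ z) := by
    intro z hz
    have hz0 : (0 : ℝ) < z := hz
    refine HasSum.tsum_eq ?_
    have h2 := ((Complex.hasSum_conj'.2 (hF z hz0)).mul_left (Real.exp (-y * z) : ℂ))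
    refine (congrArg (fun g => HasSum g _) (funext fun γ => ?_)).mp h2
    simp only [hf]
    rw [Complex.cpow_def_of_ne_zero Complex.I_ne_zero, Complex.log_I, ← Complex.ofReal_cpow hz0.le]
    simp only [map_mul, map_div₀, Complex.conj_ofReal, ← Complex.exp_conj, Complex.conj_I,
      map_ofNat, Complex.ofReal_mul, add_sub_cancel_right]
    push_cast
    ring_nf
  rw [setIntegral_congr_fun measurableSet_Ioi hconj, integral_exp_mul_conj_charFun μ hy0] at hsum
  have h3 := (hsum.mul_left (-Complex.I)).tsum_eq
  simp_rw [← mul_assoc] at h3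
  simp only [neg_mul, Complex.I_mul_I, neg_neg, one_mul] at h3
  rw [logSeries]
  simp only [neg_mul]
  rw [h3, cauchyTransform, ← integral_const_mul, ← integral_neg]
  refine integral_congr_ae (Filter.Eventually.of_forall fun x => ?_)
  simp only
  rw [show (y : ℂ) * Complex.I - x = Complex.I * (y + x * Complex.I) by
    linear_combination (-(x : ℂ)) * Complex.I_mul_I, mul_inv, Complex.inv_I]
  ring

/-- In the coordinate ζ = log w every power of w is entire, and the relevant part of the upper
half-plane becomes a convex half-strip, where the identity theorem applies. -/
lemma cauchyTransform_exp_eq_logSeries (hS : IsExponentSet S c) {μ : Measure ℝ} [IsFiniteMeasure μ]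
    (hA : 0 < A) (hm : ∀ γ ∈ S, ‖m γ‖ ≤ A ^ γ)
    (hF : ∀ z : ℝ, 0 < z → HasSum
      (fun γ : S => m γ / (Real.Gamma (γ + 1) : ℂ) * Complex.I ^ ((γ : ℝ) : ℂ) *
        (z : ℂ) ^ ((γ : ℝ) : ℂ)) (charFun μ z))
    {R : ℝ} (hR : c * A < R) {ζ : ℂ} (h1 : Real.log R < ζ.re) (h2 : 0 < ζ.im)
    (h3 : ζ.im < Real.pi) : cauchyTransform μ (Complex.exp ζ) = logSeries S m ζ := by
  have hR0 : 0 < R := (mul_pos hS.const_pos hA).trans hR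
  have hAR : c * (A / R) < 1 := by rwa [← mul_div_assoc, div_lt_one hR0]
  set U : Set ℂ := {ζ | Real.log R < ζ.re} ∩ ({ζ | 0 < ζ.im} ∩ {ζ | ζ.im < Real.pi}) with hU
  have hUo : IsOpen U := (isOpen_lt continuous_const Complex.continuous_re).inter
    ((isOpen_lt continuous_const Complex.continuous_im).inter
      (isOpen_lt Complex.continuous_im continuous_const))
  have hUc : Convex ℝ U := (convex_halfSpace_re_gt _).inter
    ((convex_halfSpace_im_gt _).inter (convex_halfSpace_im_lt _))
  have hC : DifferentiableOn ℂ (fun ζ => cauchyTransform μ (Complex.exp ζ)) U := by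
    intro ζ hζ
    refine (DifferentiableAt.comp ζ (differentiableAt_cauchyTransform μ ?_)
      Complex.differentiable_exp.differentiableAt).differentiableWithinAt
    rw [Complex.exp_im]
    exact (mul_pos (Real.exp_pos _) (Real.sin_pos_of_pos_of_lt_pi hζ.2.1 hζ.2.2)).ne'
  have hH : DifferentiableOn ℂ (logSeries S m) U :=
    differentiableOn_logSeries hS hA hR0 hAR hm hUo fun ζ hζ => le_of_lt hζ.1
  set ζ₀ : ℂ := Real.log (R + 1) + Real.pi / 2 * Complex.I with hζ₀
  have hre : ζ₀.re = Real.log (R + 1) := by simp [hζ₀]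
  have him : ζ₀.im = Real.pi / 2 := by simp [hζ₀]
  have hmem : ζ₀ ∈ U := by
    refine ⟨?_, ?_, ?_⟩
    · rw [Set.mem_ofPred_eq, hre]
      exact Real.log_lt_log hR0 (by linarith)
    · rw [Set.mem_ofPred_eq, him]; positivity
    · rw [Set.mem_ofPred_eq, him]; linarith [Real.pi_pos]
  -- The points ζ₀ + t with t > 0 correspond to w = i(R+1)e^t, where the identity is known, and they
  -- accumulate at ζ₀.
  have htend : Filter.Tendsto (fun t : ℝ => (ζ₀ + t : ℂ)) (nhdsWithin 0 (Set.Ioi 0))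
      (nhdsWithin ζ₀ {ζ₀}ᶜ) := by
    refine tendsto_nhdsWithin_iff.2 ⟨?_, ?_⟩
    · have : ContinuousAt (fun t : ℝ => (ζ₀ + t : ℂ)) 0 := by fun_prop
      simpa using this.tendsto.mono_left nhdsWithin_le_nhds
    · filter_upwards [self_mem_nhdsWithin] with t ht
      have ht0 : (0 : ℝ) < t := ht
      simp [ht0.ne']
  refine (hC.analyticOnNhd hUo).eqOn_of_preconnected_of_frequently_eq (hH.analyticOnNhd hUo)
    hUc.isPreconnected hmem (htend.frequently (Filter.Eventually.frequently ?_)) ⟨h1, h2, h3⟩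
  filter_upwards [self_mem_nhdsWithin] with t ht
  have ht0 : (0 : ℝ) < t := ht
  have hR1 : 0 < R + 1 := by linarith
  have hy : c * A < (R + 1) * Real.exp t := by nlinarith [Real.one_le_exp ht0.le]
  have key := cauchyTransform_mul_I hS hA hm hF hy
  rw [Real.log_mul hR1.ne' (Real.exp_pos t).ne', Real.log_exp] at key
  have e1 : ζ₀ + t = ((Real.log (R + 1) + t : ℝ) : ℂ) + Real.pi / 2 * Complex.I := by
    rw [hζ₀]; push_cast; ring
  rw [e1, ← key, Complex.exp_add, Complex.exp_pi_div_two_mul_I, ← Complex.ofReal_exp, Real.exp_add,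
    Real.exp_log hR1]

end series

/-! ### Poisson kernel and Stieltjes inversion. -/

/-- The Poisson kernel of the upper half-plane. -/
noncomputable def halfPlanePoisson (ε u : ℝ) : ℝ := Real.pi⁻¹ * ε * (u ^ 2 + ε ^ 2)⁻¹

lemma continuous_halfPlanePoisson {ε : ℝ} (hε : 0 < ε) : Continuous (halfPlanePoisson ε) := by
  unfold halfPlanePoisson
  exact continuous_const.mul (Continuous.inv₀ (by fun_prop) fun u => by positivity)

lemma halfPlanePoisson_nonneg {ε : ℝ} (hε : 0 < ε) (u : ℝ) : 0 ≤ halfPlanePoisson ε u := by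
  have := Real.pi_pos
  unfold halfPlanePoisson
  positivity

lemma mul_halfPlanePoisson {ε : ℝ} (hε : 0 < ε) (s : ℝ) :
    ε * halfPlanePoisson ε (ε * s) = Real.pi⁻¹ * (1 + s ^ 2)⁻¹ := by
  have : 1 + s ^ 2 ≠ 0 := by positivity
  have : (ε * s) ^ 2 + ε ^ 2 = ε ^ 2 * (1 + s ^ 2) := by ring
  rw [halfPlanePoisson, this]
  field_simp

lemma integrable_halfPlanePoisson {ε : ℝ} (hε : 0 < ε) : Integrable (halfPlanePoisson ε) := by
  rw [← integrable_comp_mul_left_iff _ hε.ne']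
  refine ((integrable_inv_one_add_sq.const_mul Real.pi⁻¹).const_mul ε⁻¹).congr
    (Filter.Eventually.of_forall fun s => ?_)
  simp only
  rw [← mul_halfPlanePoisson hε, inv_mul_cancel_left₀ hε.ne']

/-- The substitution x = t + εs moves ε from the kernel to the test function, leaving a fixed
integrable weight for dominated convergence. -/
lemma integral_mul_halfPlanePoisson {ε : ℝ} (hε : 0 < ε) (φ : ℝ → ℝ) (t : ℝ) :
    ∫ x, φ x * halfPlanePoisson ε (x - t) =
      ∫ s, φ (t + ε * s) * (Real.pi⁻¹ * (1 + s ^ 2)⁻¹) := by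
  rw [← integral_add_left_eq_self (fun x => φ x * halfPlanePoisson ε (x - t)) t]
  have h := Measure.integral_comp_mul_left (fun x => φ (t + x) * halfPlanePoisson ε x) ε
  rw [abs_of_pos (inv_pos.2 hε), smul_eq_mul, eq_inv_mul_iff_mul_eq₀ hε.ne',
    ← integral_const_mul] at h
  simp only [add_sub_cancel_left]
  rw [← h]
  refine integral_congr_ae (Filter.Eventually.of_forall fun s => ?_)
  simp only
  rw [← mul_halfPlanePoisson hε]
  ring

lemma integrable_sub_halfPlanePoisson (μ : Measure ℝ) [IsFiniteMeasure μ] {ε : ℝ} (hε : 0 < ε) :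
    Integrable (fun p : ℝ × ℝ => halfPlanePoisson ε (p.1 - p.2)) (volume.prod μ) := by
  have hc := continuous_halfPlanePoisson hε
  rw [integrable_prod_iff' (by fun_prop)]
  refine ⟨Filter.Eventually.of_forall fun t => (integrable_halfPlanePoisson hε).comp_sub_right t, ?_⟩
  have : ∀ t : ℝ, ∫ x, ‖halfPlanePoisson ε (x - t)‖ = ∫ x, ‖halfPlanePoisson ε x‖ := fun t =>
    integral_sub_right_eq_self (fun x => ‖halfPlanePoisson ε x‖) t
  simp only [this]
  exact integrable_const _

section inversion

variable (μ : Measure ℝ) [IsFiniteMeasure μ]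

lemma neg_im_cauchyTransform {ε : ℝ} (hε : 0 < ε) (x : ℝ) :
    -(Real.pi⁻¹ * (cauchyTransform μ (x + ε * Complex.I)).im) =
      ∫ t, halfPlanePoisson ε (x - t) ∂μ := by
  have hne : ∀ t : ℝ, (x + ε * Complex.I - t : ℂ) ≠ 0 := fun t h => by
    have := congrArg Complex.im h
    simp [hε.ne'] at this
  have hint : Integrable (fun t : ℝ => (x + ε * Complex.I - t : ℂ)⁻¹) μ := by
    refine Integrable.of_bound (C := ε⁻¹)
      (Continuous.inv₀ (by fun_prop) hne).aestronglyMeasurable (Filter.Eventually.of_forall fun t => ?_)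
    rw [norm_inv]
    gcongr
    have := Complex.abs_im_le_norm (x + ε * Complex.I - t : ℂ)
    simpa [abs_of_pos hε] using this
  have h : (cauchyTransform μ (x + ε * Complex.I)).im =
      ∫ t : ℝ, ((x + ε * Complex.I - t : ℂ)⁻¹).im ∂μ :=
    (Complex.imCLM.integral_comp_comm hint).symm
  rw [h, ← integral_const_mul, ← integral_neg]
  refine integral_congr_ae (Filter.Eventually.of_forall fun t => ?_)
  simp [halfPlanePoisson, Complex.inv_im, Complex.normSq_apply]
  ring

/-- **Stieltjes inversion**, tested against bounded continuous functions. -/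
lemma tendsto_integral_mul_im_cauchyTransform {φ : ℝ → ℝ} (hφ : Continuous φ) {M : ℝ}
    (hM : ∀ x, |φ x| ≤ M) :
    Filter.Tendsto (fun ε : ℝ =>
        ∫ x, φ x * -(Real.pi⁻¹ * (cauchyTransform μ (x + ε * Complex.I)).im))
      (nhdsWithin 0 (Set.Ioi 0)) (nhds (∫ t, φ t ∂μ)) := by
  have hgi : Integrable fun s : ℝ => Real.pi⁻¹ * (1 + s ^ 2)⁻¹ :=
    integrable_inv_one_add_sq.const_mul _
  have hg1 : ∫ s : ℝ, Real.pi⁻¹ * (1 + s ^ 2)⁻¹ = 1 := by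
    rw [integral_const_mul, integral_univ_inv_one_add_sq, inv_mul_cancel₀ Real.pi_ne_zero]
  have hg0 : ∀ s : ℝ, 0 ≤ Real.pi⁻¹ * (1 + s ^ 2)⁻¹ := fun s => by
    have := Real.pi_pos
    positivity
  have hgc : Continuous fun s : ℝ => Real.pi⁻¹ * (1 + s ^ 2)⁻¹ :=
    continuous_const.mul (Continuous.inv₀ (by fun_prop) fun s => by positivity)
  have hbd : ∀ ε t s : ℝ, ‖φ (t + ε * s) * (Real.pi⁻¹ * (1 + s ^ 2)⁻¹)‖ ≤
      M * (Real.pi⁻¹ * (1 + s ^ 2)⁻¹) := fun ε t s => by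
    rw [norm_mul, Real.norm_of_nonneg (hg0 s)]
    exact mul_le_mul_of_nonneg_right (hM _) (hg0 s)
  have hswap : ∀ ε ∈ Set.Ioi (0 : ℝ),
      ∫ t, (∫ s, φ (t + ε * s) * (Real.pi⁻¹ * (1 + s ^ 2)⁻¹)) ∂μ =
        ∫ x, φ x * -(Real.pi⁻¹ * (cauchyTransform μ (x + ε * Complex.I)).im) := by
    intro ε hε
    have hint : Integrable (Function.uncurry fun x t : ℝ => φ x * halfPlanePoisson ε (x - t))
        (volume.prod μ) := by
      refine (integrable_sub_halfPlanePoisson μ hε).bdd_mul (c := M) (f := fun p : ℝ × ℝ => φ p.1)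
        (by fun_prop) (Filter.Eventually.of_forall fun p => hM p.1)
    simp_rw [neg_im_cauchyTransform μ hε, ← integral_mul_halfPlanePoisson hε, ← integral_const_mul]
    exact (integral_integral_swap hint).symm
  -- Dominated convergence is used twice: with the constant M over t, then with M times the Cauchy
  -- density over s.
  refine Filter.Tendsto.congr' (eventually_nhdsWithin_of_forall hswap) ?_
  refine tendsto_integral_filter_of_norm_le_const (Filter.Eventually.of_forall fun ε => ?_)
    ⟨M, Filter.Eventually.of_forall fun ε => Filter.Eventually.of_forall fun t => ?_⟩
    (Filter.Eventually.of_forall fun t => ?_)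
  · refine (StronglyMeasurable.integral_prod_right
      (f := fun t s : ℝ => φ (t + ε * s) * (Real.pi⁻¹ * (1 + s ^ 2)⁻¹)) ?_).aestronglyMeasurable
    have hc : Continuous fun p : ℝ × ℝ => φ (p.1 + ε * p.2) * (Real.pi⁻¹ * (1 + p.2 ^ 2)⁻¹) :=
      (by fun_prop : Continuous fun p : ℝ × ℝ => φ (p.1 + ε * p.2)).mul (hgc.comp continuous_snd)
    exact hc.stronglyMeasurable
  · calc _ ≤ ∫ s, M * (Real.pi⁻¹ * (1 + s ^ 2)⁻¹) :=
          norm_integral_le_of_norm_le (hgi.const_mul M) (Filter.Eventually.of_forall (hbd ε t))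
      _ = M := by rw [integral_const_mul, hg1, mul_one]
  · have h2 : φ t = ∫ s : ℝ, φ t * (Real.pi⁻¹ * (1 + s ^ 2)⁻¹) := by
      rw [integral_const_mul, hg1, mul_one]
    rw [h2]
    refine tendsto_integral_filter_of_dominated_convergence
      (fun s => M * (Real.pi⁻¹ * (1 + s ^ 2)⁻¹)) (Filter.Eventually.of_forall fun ε => ?_)
      (Filter.Eventually.of_forall fun ε => Filter.Eventually.of_forall (hbd ε t))
      (hgi.const_mul M) (Filter.Eventually.of_forall fun s => ?_)
    · exact (by fun_prop : Continuous _).aestronglyMeasurable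
    · have : ContinuousAt (fun ε => φ (t + ε * s) * (Real.pi⁻¹ * (1 + s ^ 2)⁻¹)) 0 := by fun_prop
      simpa using this.tendsto.mono_left nhdsWithin_le_nhds

end inversion

/-! ### From the Fourier series to the tail density. -/

/-- A negative x lies on the branch cut, but the approach from above is on the side where the
principal logarithm is continuous. -/
lemma tendsto_log_add_mul_I {x : ℝ} (hx : x ≠ 0) :
    Filter.Tendsto (fun ε : ℝ => Complex.log (x + ε * Complex.I)) (nhdsWithin 0 (Set.Ioi 0))
      (nhds (Complex.log x)) := by
  have hc : Filter.Tendsto (fun ε : ℝ => (x + ε * Complex.I : ℂ)) (nhdsWithin 0 (Set.Ioi 0))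
      (nhds (x : ℂ)) := by
    have : ContinuousAt (fun ε : ℝ => (x + ε * Complex.I : ℂ)) 0 := by fun_prop
    simpa using this.tendsto.mono_left nhdsWithin_le_nhds
  rcases hx.lt_or_gt with h | h
  · refine (Complex.continuousWithinAt_log_of_re_neg_of_im_zero (z := (x : ℂ)) (by simpa using h)
      (by simp)).tendsto.comp (tendsto_nhdsWithin_iff.2 ⟨hc, ?_⟩)
    filter_upwards [self_mem_nhdsWithin] with ε hε
    simpa using le_of_lt (Set.mem_Ioi.1 hε)
  · exact (continuousAt_clog (Or.inl (by simpa using h))).tendsto.comp hc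

section converse

variable {S : AddSubsemigroup ℝ} {c : ℝ} {m : ℝ → ℂ} {A R : ℝ}

lemma neg_im_logSeries_log (hS : IsExponentSet S c) (hA : 0 < A) (hR : 0 < R)
    (hAR : c * (A / R) < 1) (hm : ∀ γ ∈ S, ‖m γ‖ ≤ A ^ γ) (hm0 : m 0 = 1) {x : ℝ} (hx : R ≤ |x|) :
    -(Real.pi⁻¹ * (logSeries S m (Complex.log x)).im) =
      tailDensity S (fun β => m β / Real.pi) x := by
  have hx0 : x ≠ 0 := abs_pos.1 (hR.trans_le hx)
  have hre : Real.log R ≤ (Complex.log x).re := by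
    rw [Complex.log_re, Complex.norm_real, Real.norm_eq_abs]
    exact Real.log_le_log hR hx
  have hs : Summable fun γ : S => (starRingEnd ℂ) (m γ) *
      Complex.exp (-((γ : ℝ) + 1) * Complex.log x) :=
    Summable.of_norm_bounded (summable_logSeries_bound hS hA hR hAR)
      fun γ => norm_logSeries_term_le hA hR hm γ.2 (hS.nonneg γ γ.2) hre
  have h1 := ((Complex.hasSum_im hs.hasSum).mul_left Real.pi⁻¹).neg
  have h2 := (hS.hasSum_pos_iff (f := fun γ : ℝ => -(Real.pi⁻¹ * ((starRingEnd ℂ) (m γ) *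
      Complex.exp (-((γ : ℝ) + 1) * Complex.log x)).im)) ?_).2 h1
  · rw [logSeries, ← h2.tsum_eq, tailDensity]
    refine tsum_congr fun β => ?_
    have h3 : m β / Real.pi * invPow x (β + 1) = (starRingEnd ℂ) ((starRingEnd ℂ) (m β) *
        Complex.exp (-((β : ℝ) + 1) * Complex.log x)) / (Real.pi : ℝ) := by
      rw [invPow_eq_conj_exp hx0, map_mul, Complex.conj_conj]
      push_cast
      ring
    rw [h3, Complex.div_ofReal_im, Complex.conj_im]
    ring
  -- The γ = 0 term is 1/x, with zero imaginary part; this is where c_0 = 1 enters.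
  · rw [hm0]
    simp [Complex.exp_neg, Complex.exp_log (Complex.ofReal_ne_zero.2 hx0), Complex.inv_im]

lemma neg_im_cauchyTransform_eq (hS : IsExponentSet S c) {μ : Measure ℝ} [IsFiniteMeasure μ]
    (hA : 0 < A) (hm : ∀ γ ∈ S, ‖m γ‖ ≤ A ^ γ)
    (hF : ∀ z : ℝ, 0 < z → HasSum
      (fun γ : S => m γ / (Real.Gamma (γ + 1) : ℂ) * Complex.I ^ ((γ : ℝ) : ℂ) *
        (z : ℂ) ^ ((γ : ℝ) : ℂ)) (charFun μ z))
    (hR : c * A < R) {x ε : ℝ} (hx : R ≤ |x|) (hε : 0 < ε) :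
    Real.log R ≤ (Complex.log (x + ε * Complex.I)).re ∧
    cauchyTransform μ (x + ε * Complex.I) = logSeries S m (Complex.log (x + ε * Complex.I)) := by
  have hR0 : 0 < R := (mul_pos hS.const_pos hA).trans hR
  have him : (x + ε * Complex.I : ℂ).im = ε := by simp
  have hne : (x + ε * Complex.I : ℂ) ≠ 0 := fun h => by
    rw [h] at him
    exact hε.ne him
  have hnorm : R < ‖(x + ε * Complex.I : ℂ)‖ := by
    refine hx.trans_lt ?_
    have := Complex.abs_re_lt_norm (z := (x + ε * Complex.I : ℂ)) |>.2 (by rw [him]; exact hε.ne')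
    simpa using this
  have h1 : Real.log R < (Complex.log (x + ε * Complex.I)).re := by
    rw [Complex.log_re]
    exact Real.log_lt_log hR0 hnorm
  refine ⟨h1.le, ?_⟩
  rw [← cauchyTransform_exp_eq_logSeries hS hA hm hF hR h1, Complex.exp_log hne]
  · rw [Complex.log_im]
    refine lt_of_le_of_ne (Complex.arg_nonneg_iff.2 (by rw [him]; exact hε.le)) fun h => ?_
    have := (Complex.arg_eq_zero_iff.1 h.symm).2
    rw [him] at this
    exact hε.ne' this
  · rw [Complex.log_im]
    exact Complex.arg_lt_pi_iff.2 (Or.inr (by rw [him]; exact hε.ne'))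

theorem memPS_of_hasSum_charFun (hS : IsExponentSet S c) {μ : Measure ℝ} [IsFiniteMeasure μ]
    (hA : 0 < A) (hm : ∀ γ ∈ S, ‖m γ‖ ≤ A ^ γ) (hm0 : m 0 = 1)
    (hF : ∀ z : ℝ, 0 < z → HasSum
      (fun γ : S => m γ / (Real.Gamma (γ + 1) : ℂ) * Complex.I ^ ((γ : ℝ) : ℂ) *
        (z : ℂ) ^ ((γ : ℝ) : ℂ)) (charFun μ z)) : MemPS S c μ := by
  -- Two radii leave room for a continuous cut-off: everything is controlled for |x| ≥ R₁, and the
  -- conclusion is drawn on the smaller set |x| ≥ R.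
  obtain ⟨R₁, hR₁⟩ := exists_gt (c * A)
  obtain ⟨R, hR⟩ := exists_gt R₁
  have hR₁0 : 0 < R₁ := (mul_pos hS.const_pos hA).trans hR₁
  have hR0 : 0 < R := hR₁0.trans hR
  have hAR : c * (A / R₁) < 1 := by rwa [← mul_div_assoc, div_lt_one hR₁0]
  set a : ℝ → ℂ := fun β => m β / Real.pi with ha
  have ha' : ∀ β ∈ S, 0 < β → ‖a β‖ ≤ A ^ β := fun β hβ _ => by
    rw [ha, norm_div, Complex.norm_real, Real.norm_of_nonneg Real.pi_pos.le]
    exact (div_le_self (norm_nonneg _) (by linarith [Real.pi_gt_three])).trans (hm β hβ)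
  set K : ℝ := ∑' β : {β : ℝ // β ∈ S ∧ 0 < β}, R₁⁻¹ * (A / R₁) ^ (β : ℝ) with hK
  set g : ℝ → ℝ := Set.indicator {x | R₁ ≤ |x|} (tailDensity S a) with hg
  have hgcont : ContinuousOn (tailDensity S a) {x | R₁ ≤ |x|} :=
    continuousOn_tailDensity hS hA hR₁0 hAR ha'
  have hgmeas : Measurable g := hgcont.measurable_piecewise (g := 0) continuousOn_const
    (measurableSet_le_abs R₁)
  set h : ℝ → ℝ → ℝ := fun ε x => -(Real.pi⁻¹ * (cauchyTransform μ (x + ε * Complex.I)).im) with hh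
  have hlim : ∀ x, R₁ ≤ |x| → Filter.Tendsto (fun ε => h ε x) (nhdsWithin 0 (Set.Ioi 0))
      (nhds (tailDensity S a x)) := by
    intro x hx
    have hx0 : x ≠ 0 := abs_pos.1 (hR₁0.trans_le hx)
    rw [← neg_im_logSeries_log hS hA hR₁0 hAR hm hm0 hx]
    have hre : Real.log R₁ ≤ (Complex.log x).re := by
      rw [Complex.log_re, Complex.norm_real, Real.norm_eq_abs]
      exact Real.log_le_log hR₁0 hx
    have h1 : Filter.Tendsto (fun ε : ℝ => logSeries S m (Complex.log (x + ε * Complex.I)))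
        (nhdsWithin 0 (Set.Ioi 0)) (nhds (logSeries S m (Complex.log x))) := by
      refine (continuousOn_logSeries hS hA hR₁0 hAR hm _ hre).tendsto.comp
        (tendsto_nhdsWithin_iff.2 ⟨tendsto_log_add_mul_I hx0, ?_⟩)
      filter_upwards [self_mem_nhdsWithin] with ε hε
      exact (neg_im_cauchyTransform_eq hS hA hm hF hR₁ hx hε).1
    refine Filter.Tendsto.congr' ?_
      (((Complex.continuous_im.tendsto _).comp h1).const_mul Real.pi⁻¹).neg
    filter_upwards [self_mem_nhdsWithin] with ε hε
    rw [hh]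
    simp only [Function.comp_apply]
    rw [(neg_im_cauchyTransform_eq hS hA hm hF hR₁ hx hε).2]
  set K' : ℝ := Real.pi⁻¹ * ∑' γ : S, R₁⁻¹ * (A / R₁) ^ (γ : ℝ) with hK'
  have hbound : ∀ ε ∈ Set.Ioi (0 : ℝ), ∀ x, R₁ ≤ |x| → |h ε x| ≤ K' := by
    intro ε hε x hx
    have h1 := neg_im_cauchyTransform_eq hS hA hm hF hR₁ hx hε
    rw [hh]
    simp only
    rw [h1.2, abs_neg, abs_mul, abs_of_pos (inv_pos.2 Real.pi_pos)]
    exact mul_le_mul_of_nonneg_left ((Complex.abs_im_le_norm _).trans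
      (norm_logSeries_le hS hA hR₁0 hAR hm h1.1)) (inv_pos.2 Real.pi_pos).le
  -- The density is a pointwise limit of Poisson integrals of a positive measure.
  have hnonneg : ∀ x, R₁ ≤ |x| → 0 ≤ tailDensity S a x := by
    intro x hx
    refine ge_of_tendsto (hlim x hx) ?_
    filter_upwards [self_mem_nhdsWithin] with ε hε
    rw [hh]
    simp only
    rw [neg_im_cauchyTransform μ hε]
    exact integral_nonneg fun t => halfPlanePoisson_nonneg hε _
  have hg0 : ∀ x, 0 ≤ g x := fun x => Set.indicator_nonneg (fun x hx => hnonneg x hx) x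
  have hgK : ∀ x, g x ≤ max K 0 := fun x => by
    by_cases hx : R₁ ≤ |x|
    · rw [hg, Set.indicator_of_mem (show x ∈ {x | R₁ ≤ |x|} from hx)]
      exact (le_abs_self _).trans
        ((abs_tailDensity_le hS hA hR₁0 hAR ha' hx).trans (le_max_left _ _))
    · rw [hg, Set.indicator_of_notMem (show x ∉ {x | R₁ ≤ |x|} from hx)]
      exact le_max_right _ _
  set ψ : ℝ → ℝ := fun x => max 0 (min 1 ((|x| - R₁) / (R - R₁))) with hψ
  have hψc : Continuous ψ := by
    rw [hψ]; fun_prop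
  have hψ0 : ∀ x, 0 ≤ ψ x := fun x => le_max_left _ _
  have hψ1 : ∀ x, ψ x ≤ 1 := fun x => max_le zero_le_one (min_le_left _ _)
  have hψin : ∀ x, R ≤ |x| → ψ x = 1 := fun x hx => by
    have : 1 ≤ (|x| - R₁) / (R - R₁) := by
      rw [one_le_div (by linarith)]; linarith
    simp [hψ, this]
  have hψout : ∀ x, ¬ R₁ ≤ |x| → ψ x = 0 := fun x hx => by
    have : (|x| - R₁) / (R - R₁) ≤ 0 :=
      div_nonpos_of_nonpos_of_nonneg (by linarith) (by linarith)
    simp [hψ, this]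
  -- the cut-off measures agree
  have hcut : μ.withDensity (fun x => ENNReal.ofReal (ψ x)) =
      volume.withDensity (fun x => ENNReal.ofReal (ψ x * g x)) := by
    have hf1 : IsFiniteMeasureOnCompacts (μ.withDensity fun x => ENNReal.ofReal (ψ x)) :=
      have := IsLocallyFiniteMeasure.withDensity_ofReal (μ := μ) hψc
      inferInstance
    have hf2 : IsFiniteMeasureOnCompacts
        (volume.withDensity fun x => ENNReal.ofReal (ψ x * g x)) := by
      refine ⟨fun C hC => ?_⟩
      calc (volume.withDensity fun x => ENNReal.ofReal (ψ x * g x)) C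
          ≤ (volume.withDensity fun _ => ENNReal.ofReal (max K 0)) C := by
            refine withDensity_mono (Filter.Eventually.of_forall fun x => ?_) C
            refine ENNReal.ofReal_le_ofReal ?_
            calc ψ x * g x ≤ 1 * g x := mul_le_mul_of_nonneg_right (hψ1 x) (hg0 x)
              _ ≤ _ := by rw [one_mul]; exact hgK x
        _ < ⊤ := by
            rw [withDensity_const, Measure.smul_apply, smul_eq_mul]
            exact ENNReal.mul_lt_top ENNReal.ofReal_lt_top hC.measure_lt_top
    refine Measure.ext_of_integral_eq_on_compactlySupported fun f => ?_
    rw [integral_withDensity_eq_integral_toReal_smul (by fun_prop)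
      (Filter.Eventually.of_forall fun x => ENNReal.ofReal_lt_top),
      integral_withDensity_eq_integral_toReal_smul (by fun_prop)
      (Filter.Eventually.of_forall fun x => ENNReal.ofReal_lt_top)]
    simp only [ENNReal.toReal_ofReal (hψ0 _), ENNReal.toReal_ofReal (mul_nonneg (hψ0 _) (hg0 _)),
      smul_eq_mul]
    obtain ⟨M, hM⟩ := f.hasCompactSupport.exists_bound_of_continuous f.continuous
    have hφM : ∀ x, |ψ x * f x| ≤ M := fun x => by
      rw [abs_mul, abs_of_nonneg (hψ0 x)]
      exact (mul_le_of_le_one_left (abs_nonneg _) (hψ1 x)).trans (hM x)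
    have hT : Filter.Tendsto (fun ε => ∫ x, ψ x * f x * h ε x) (nhdsWithin 0 (Set.Ioi 0))
        (nhds (∫ x, ψ x * f x ∂μ)) :=
      tendsto_integral_mul_im_cauchyTransform μ (hψc.mul f.continuous) hφM
    -- Stieltjes inversion gives one limit. The same integrals also converge by domination, since ψ
    -- confines them to |x| ≥ R₁, where `h` is bounded by `K'` and has the tail density as limit.
    refine tendsto_nhds_unique hT ?_
    have hmeas : ∀ ε ∈ Set.Ioi (0 : ℝ), AEStronglyMeasurable (fun x => ψ x * f x * h ε x) := by
      intro ε hε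
      have hcd : Continuous fun x : ℝ => cauchyTransform μ (x + ε * Complex.I) := by
        refine continuous_iff_continuousAt.2 fun x => ?_
        refine ContinuousAt.comp (f := fun x : ℝ => (x + ε * Complex.I : ℂ))
          (differentiableAt_cauchyTransform μ ?_).continuousAt (by fun_prop)
        simpa using (ne_of_gt hε)
      have hc : Continuous fun x => ψ x * f x * h ε x :=
        (hψc.mul f.continuous).mul
          ((continuous_const.mul (Complex.continuous_im.comp hcd)).neg)
      exact hc.aestronglyMeasurable
    refine tendsto_integral_filter_of_dominated_convergence (fun x => K' * |f x|)
      (eventually_nhdsWithin_of_forall hmeas) (eventually_nhdsWithin_of_forall fun ε hε =>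
        Filter.Eventually.of_forall fun x => ?_)
      ((f.continuous.integrable_of_hasCompactSupport f.hasCompactSupport).abs.const_mul K')
      (Filter.Eventually.of_forall fun x => ?_)
    · by_cases hx : R₁ ≤ |x|
      · rw [norm_mul, norm_mul, Real.norm_of_nonneg (hψ0 x), Real.norm_eq_abs, Real.norm_eq_abs]
        have h1 := hbound ε hε x hx
        calc ψ x * |f x| * |h ε x| ≤ 1 * |f x| * K' := by
              gcongr
              exact hψ1 x
          _ = K' * |f x| := by ring
      · rw [hψout x hx, zero_mul, zero_mul, norm_zero]
        have hK'0 : 0 ≤ K' := by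
          have := Real.pi_pos
          exact mul_nonneg (by positivity) (tsum_nonneg fun γ => by positivity)
        positivity
    · by_cases hx : R₁ ≤ |x|
      · rw [show ψ x * g x * f x = ψ x * f x * tailDensity S a x by
          rw [hg, Set.indicator_of_mem (show x ∈ {x | R₁ ≤ |x|} from hx)]; ring]
        exact (hlim x hx).const_mul _
      · simp [hψout x hx]
  have hD := measurableSet_le_abs R
  refine ⟨a, A, R, hA, hR0, ha', ?_, ?_, ?_⟩
  · rw [inv_mul_eq_div, lt_div_iff₀ hS.const_pos, mul_comm]
    exact hR₁.trans hR
  · filter_upwards [ae_restrict_mem hD] with x hx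
    exact hnonneg x (hR.le.trans hx)
  -- On |x| ≥ R the cut-off equals 1, so restricting `hcut` there removes ψ from both sides.
  · have h1 := congrArg (fun ν : Measure ℝ => ν.restrict {x | R ≤ |x|}) hcut
    simp only [restrict_withDensity hD] at h1
    rw [withDensity_congr_ae (g := 1), withDensity_one] at h1
    · rw [h1]
      refine withDensity_congr_ae ?_
      filter_upwards [ae_restrict_mem hD] with x hx
      rw [hψin x hx, one_mul, hg,
        Set.indicator_of_mem (show x ∈ {x | R₁ ≤ |x|} from hR.le.trans hx)]
    · filter_upwards [ae_restrict_mem hD] with x hx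
      rw [hψin x hx, ENNReal.ofReal_one, Pi.one_apply]

end converse

lemma HasSum.of_eq {ι E : Type*} [AddCommMonoid E] [TopologicalSpace E] {f g : ι → E} {a b : E}
    (h : HasSum f a) (hf : ∀ i, f i = g i) (ha : a = b) : HasSum g b := by
  obtain rfl : f = g := funext hf
  rwa [← ha]

/-! ### Power series of the incomplete Gamma integral. -/

section incompleteGamma

lemma integrableOn_exp_neg_mul_rpow {s R : ℝ} (hs : 0 < s) (hR : 0 < R) (q : ℝ) :
    IntegrableOn (fun x => Real.exp (-s * x) * x ^ q) (Set.Ioi R) := by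
  refine integrable_of_isBigO_exp_neg (b := s / 2) (by linarith) ?_ ?_
  · intro x hx
    have hx0 : x ≠ 0 := (hR.trans_le hx).ne'
    exact ((by fun_prop : ContinuousAt (fun x => Real.exp (-s * x)) x).mul
      (continuousAt_id.rpow_const (Or.inl hx0))).continuousWithinAt
  · have h := (tendsto_rpow_mul_exp_neg_mul_atTop_nhds_zero q (s / 2) (by linarith)).isBigO_one ℝ
    refine ((Asymptotics.isBigO_refl (fun x => Real.exp (-(s / 2) * x)) Filter.atTop).mul h).congr
      (fun x => ?_) (fun x => mul_one _)
    rw [mul_comm (x ^ q), ← mul_assoc, ← Real.exp_add]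
    ring_nf

/-- Integration by parts: the recursion relating β to β - 1. -/
lemma mul_integral_exp_neg_mul_rpow {s R : ℝ} (hs : 0 < s) (hR : 0 < R) (β : ℝ) :
    β * (∫ x in Set.Ioi R, Real.exp (-s * x) * x ^ (-β - 1)) =
      R ^ (-β) * Real.exp (-s * R) - s * ∫ x in Set.Ioi R, Real.exp (-s * x) * x ^ (-(β - 1) - 1) := by
  have h1 := (integrableOn_exp_neg_mul_rpow hs hR (-β - 1)).const_mul β
  have h2 := (integrableOn_exp_neg_mul_rpow hs hR (-(β - 1) - 1)).const_mul s
  have hd : ∀ x ∈ Set.Ici R, HasDerivAt (fun x => -(x ^ (-β) * Real.exp (-s * x)))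
      (β * (Real.exp (-s * x) * x ^ (-β - 1)) + s * (Real.exp (-s * x) * x ^ (-(β - 1) - 1))) x := by
    intro x hx
    have hx0 : x ≠ 0 := (hR.trans_le hx).ne'
    have he : HasDerivAt (fun x => Real.exp (-s * x)) (Real.exp (-s * x) * (-s)) x := by
      simpa using ((hasDerivAt_id x).const_mul (-s)).exp
    refine ((Real.hasDerivAt_rpow_const (p := -β) (Or.inl hx0)).mul he).neg.congr_deriv ?_
    rw [show -(β - 1) - 1 = -β by ring]
    ring
  have ht : Filter.Tendsto (fun x => -(x ^ (-β) * Real.exp (-s * x))) Filter.atTop (nhds 0) := by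
    simpa using (tendsto_rpow_mul_exp_neg_mul_atTop_nhds_zero (-β) s hs).neg
  have h3 := integral_Ioi_of_hasDerivAt_of_tendsto' hd (h1.add h2) ht
  rw [integral_add h1 h2, integral_const_mul, integral_const_mul] at h3
  linarith

/-- For β < 0 the integral over (0, ∞) converges to Γ(-β) s^β; the remaining piece over (0, R] is
integrated termwise after expanding e^{-sx}. -/
lemma hasSum_incompleteGamma_of_neg {s R β : ℝ} (hs : 0 < s) (hR : 0 < R) (hβ : β < 0) :
    HasSum (fun n : ℕ => (-s) ^ n / (n.factorial : ℝ) * (R ^ (n - β) / (n - β)))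
      (Real.Gamma (-β) * s ^ β - ∫ x in Set.Ioi R, Real.exp (-s * x) * x ^ (-β - 1)) := by
  have hp : ∀ n : ℕ, 0 < (n : ℝ) - β := fun n => by
    have : (0 : ℝ) ≤ n := n.cast_nonneg
    linarith
  have hint : ∀ n : ℕ, IntegrableOn (fun x : ℝ => x ^ ((n : ℝ) - β - 1)) (Set.Ioc 0 R) := fun n =>
    (intervalIntegrable_iff_integrableOn_Ioc_of_le hR.le).1
      (intervalIntegral.intervalIntegrable_rpow' (by linarith [hp n]))
  have hval : ∀ n : ℕ, ∫ x in Set.Ioc 0 R, x ^ ((n : ℝ) - β - 1) = R ^ ((n : ℝ) - β) / (n - β) := by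
    intro n
    rw [← intervalIntegral.integral_of_le hR.le, integral_rpow (Or.inl (by linarith [hp n])),
      sub_add_cancel, Real.zero_rpow (hp n).ne', sub_zero]
  have hnorm : ∀ n : ℕ, ∫ x in Set.Ioc 0 R, ‖(-s) ^ n / (n.factorial : ℝ) * x ^ ((n : ℝ) - β - 1)‖ =
      s ^ n / (n.factorial : ℝ) * (R ^ ((n : ℝ) - β) / (n - β)) := by
    intro n
    rw [← hval, ← integral_const_mul]
    refine setIntegral_congr_fun measurableSet_Ioc fun x hx => ?_
    have hx0 : 0 < x := hx.1
    rw [norm_mul, norm_div, norm_pow, norm_neg, Real.norm_of_nonneg hs.le,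
      Real.norm_of_nonneg (by positivity), Real.norm_of_nonneg (by positivity)]
  have hsum := hasSum_integral_of_summable_integral_norm (μ := volume.restrict (Set.Ioc 0 R))
    (F := fun (n : ℕ) (x : ℝ) => (-s) ^ n / (n.factorial : ℝ) * x ^ ((n : ℝ) - β - 1))
    (fun n => (hint n).const_mul _) ?_
  · simp only [integral_const_mul, hval] at hsum
    refine hsum.of_eq (fun _ => rfl) ?_
    have h1 : ∀ x ∈ Set.Ioc 0 R, ∑' n : ℕ, (-s) ^ n / (n.factorial : ℝ) * x ^ ((n : ℝ) - β - 1) =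
        Real.exp (-s * x) * x ^ (-β - 1) := by
      intro x hx
      rw [Real.exp_eq_exp_ℝ, NormedSpace.exp_eq_tsum_div, ← tsum_mul_right]
      refine tsum_congr fun n => ?_
      rw [show (n : ℝ) - β - 1 = n + (-β - 1) by ring, Real.rpow_add hx.1, Real.rpow_natCast, mul_pow]
      ring
    rw [setIntegral_congr_fun measurableSet_Ioc h1]
    have h2 := Real.integral_rpow_mul_exp_neg_mul_Ioi (a := -β) (r := s) (by linarith) hs
    have h3 : ∫ x in Set.Ioi (0 : ℝ), Real.exp (-s * x) * x ^ (-β - 1) =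
        Real.Gamma (-β) * s ^ β := by
      rw [one_div, Real.inv_rpow hs.le, Real.rpow_neg hs.le, inv_inv, mul_comm (s ^ β)] at h2
      rw [← h2]
      refine integral_congr_ae (Filter.Eventually.of_forall fun x => ?_)
      simp only
      rw [neg_mul, mul_comm]
    symm
    rw [← h3, ← Set.Ioc_union_Ioi_eq_Ioi hR.le, setIntegral_union
      (Set.Ioc_disjoint_Ioi le_rfl) measurableSet_Ioi]
    · ring
    · have h0 := hint 0
      simp only [Nat.cast_zero, zero_sub] at h0
      refine Integrable.mono' h0 (by fun_prop) ?_
      filter_upwards [ae_restrict_mem measurableSet_Ioc] with x hx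
      have hx0 : 0 < x := hx.1
      rw [Real.norm_of_nonneg (by positivity)]
      refine mul_le_of_le_one_left (by positivity) (Real.exp_le_one_iff.2 ?_)
      nlinarith
    · exact integrableOn_exp_neg_mul_rpow hs hR _
  · simp only [hnorm]
    refine Summable.of_nonneg_of_le (fun n => ?_) (fun n => ?_)
      ((Real.summable_pow_div_factorial (s * R)).mul_right (R ^ (-β) / (-β)))
    · have := hp n
      positivity
    · have hn : (0 : ℝ) ≤ n := n.cast_nonneg
      have hb : 0 < -β := by linarith
      have := hp n
      calc s ^ n / (n.factorial : ℝ) * (R ^ ((n : ℝ) - β) / (n - β))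
          ≤ s ^ n / (n.factorial : ℝ) * (R ^ ((n : ℝ) - β) / (-β)) := by
            gcongr
            linarith
        _ = _ := by
            rw [sub_eq_add_neg, Real.rpow_add hR, Real.rpow_natCast, mul_pow]
            ring

/-- Induction extends the negative case to every non-integer β. At the level of coefficients the
recursion is the identity n/(n-β) - 1 = β/(n-β). -/
lemma hasSum_incompleteGamma {s R β : ℝ} (hs : 0 < s) (hR : 0 < R) (hβ : ∀ n : ℕ, β ≠ n) :
    HasSum (fun n : ℕ => (-s) ^ n / (n.factorial : ℝ) * (R ^ (n - β) / (n - β)))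
      (Real.Gamma (-β) * s ^ β - ∫ x in Set.Ioi R, Real.exp (-s * x) * x ^ (-β - 1)) := by
  obtain ⟨k, hk⟩ := exists_nat_gt β
  induction k generalizing β with
  | zero => exact hasSum_incompleteGamma_of_neg hs hR (by simpa using hk)
  | succ k ih =>
    have hβ0 : β ≠ 0 := by simpa using hβ 0
    have ih' := ih (β := β - 1) (fun n hn => hβ (n + 1) (by push_cast; linarith))
      (by push_cast at hk; linarith)
    have h1 : HasSum (fun n : ℕ => (-s) ^ n / (n.factorial : ℝ) * (R ^ ((n : ℝ) - β) * (n / (n - β))))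
        (-s * (Real.Gamma (-(β - 1)) * s ^ (β - 1) -
          ∫ x in Set.Ioi R, Real.exp (-s * x) * x ^ (-(β - 1) - 1))) := by
      -- The factor n kills the zeroth term, so the series is the one for β - 1 with its index
      -- shifted by one.
      rw [← hasSum_nat_add_iff' 1]
      simp only [Finset.range_one, Finset.sum_singleton, Nat.cast_zero, zero_div, mul_zero, sub_zero]
      refine (ih'.mul_left (-s)).of_eq (fun n => ?_) rfl
      have hn : (n : ℝ) + 1 ≠ 0 := by positivity
      have hf : (n.factorial : ℝ) ≠ 0 := by positivity
      have e : (n : ℝ) - (β - 1) = n + 1 - β := by ring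
      have hne : (n : ℝ) + 1 - β ≠ 0 := by
        have := hβ (n + 1)
        push_cast at this
        exact sub_ne_zero.2 this.symm
      rw [e, Nat.factorial_succ]
      push_cast
      field_simp
      ring
    have h2 : HasSum (fun n : ℕ => (-s) ^ n / (n.factorial : ℝ) * R ^ ((n : ℝ) - β))
        (R ^ (-β) * Real.exp (-s * R)) := by
      have := (NormedSpace.expSeries_div_hasSum_exp (-s * R)).mul_left (R ^ (-β))
      rw [← Real.exp_eq_exp_ℝ] at this
      refine this.of_eq (fun n => ?_) rfl
      rw [sub_eq_add_neg, Real.rpow_add hR, Real.rpow_natCast, mul_pow]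
      ring
    have h3 := (h1.sub h2).mul_left β⁻¹
    have hI := mul_integral_exp_neg_mul_rpow hs hR β
    have hG : Real.Gamma (-(β - 1)) = -β * Real.Gamma (-β) := by
      rw [← Real.Gamma_add_one (neg_ne_zero.2 hβ0)]
      ring_nf
    have hpow : s ^ β = s ^ (β - 1) * s := by
      rw [← Real.rpow_add_one hs.ne', sub_add_cancel]
    refine h3.of_eq (fun n => ?_) ?_
    · have hne : (n : ℝ) - β ≠ 0 := sub_ne_zero.2 (hβ n).symm
      field_simp
      ring
    · rw [hG, hpow, inv_mul_eq_iff_eq_mul₀ hβ0]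
      linear_combination hI

end incompleteGamma

/-! ### Rotating the ray of integration. -/

/-- The integral of `exp (κ x) x ^ (-β - 1)` over `(R, ∞)`. -/
noncomputable def rayIntegral (β R : ℝ) (κ : ℂ) : ℂ :=
  ∫ x in Set.Ioi R, Complex.exp (κ * x) * ((x ^ (-β - 1) : ℝ) : ℂ)

/-- The integral of `w ^ (s - 1)` along the arc of the unit circle from angle `θ₁` to `θ₂`. -/
noncomputable def arcIntegral (θ₁ θ₂ s : ℝ) : ℂ := Complex.I * ∫ θ in θ₁..θ₂, Complex.exp ((θ * s : ℝ) * Complex.I)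

lemma norm_arcIntegral_le {θ₁ θ₂ : ℝ} (h : θ₁ ≤ θ₂) (s : ℝ) : ‖arcIntegral θ₁ θ₂ s‖ ≤ θ₂ - θ₁ := by
  rw [arcIntegral, norm_mul, Complex.norm_I, one_mul]
  refine (intervalIntegral.norm_integral_le_of_norm_le_const (C := 1) fun θ _ => ?_).trans ?_
  · rw [Complex.norm_exp_ofReal_mul_I]
  · rw [abs_of_nonneg (sub_nonneg.2 h), one_mul]

lemma integrableOn_rayIntegral {β R : ℝ} (hβ : 0 < β) (hR : 0 < R) {κ : ℂ} (hκ : κ.re ≤ 0) :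
    IntegrableOn (fun x : ℝ => Complex.exp (κ * x) * ((x ^ (-β - 1) : ℝ) : ℂ)) (Set.Ioi R) := by
  refine Integrable.mono' (integrableOn_Ioi_rpow_of_lt (by linarith : -β - 1 < -1) hR)
    (by fun_prop) ?_
  filter_upwards [ae_restrict_mem measurableSet_Ioi] with x hx
  have hx0 : 0 < x := hR.trans hx
  rw [norm_mul, Complex.norm_real, Real.norm_of_nonneg (by positivity), Complex.norm_exp]
  refine mul_le_of_le_one_left (by positivity) (Real.exp_le_one_iff.2 ?_)
  simp only [Complex.mul_re, Complex.ofReal_re, Complex.ofReal_im, mul_zero, sub_zero]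
  nlinarith

section rotation

variable {β : ℝ} {κ : ℂ}

lemma norm_exp_mul_exp_sub_le {u θ : ℝ} (h : (κ * Complex.exp (θ * Complex.I)).re ≤ 0) :
    ‖Complex.exp (κ * Complex.exp (u + θ * Complex.I) - β * (u + θ * Complex.I))‖ ≤
      Real.exp (-β * u) := by
  rw [Complex.norm_exp, Real.exp_le_exp, Complex.exp_add, ← Complex.ofReal_exp,
    mul_left_comm κ, Complex.sub_re, Complex.re_ofReal_mul, Complex.re_ofReal_mul]
  simp only [Complex.add_re, Complex.ofReal_re, Complex.mul_re, Complex.I_re, mul_zero,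
    Complex.ofReal_im, Complex.I_im, mul_one, sub_self, add_zero]
  simp only [Complex.mul_re] at h
  nlinarith [Real.exp_pos u]

lemma integrableOn_exp_mul_exp_sub {θ L : ℝ} (hβ : 0 < β)
    (h : (κ * Complex.exp (θ * Complex.I)).re ≤ 0) :
    IntegrableOn (fun u : ℝ => Complex.exp (κ * Complex.exp (u + θ * Complex.I) -
      β * (u + θ * Complex.I))) (Set.Ioi L) :=
  Integrable.mono' (exp_neg_integrableOn_Ioi L hβ) (by fun_prop)
    (Filter.Eventually.of_forall fun _ => norm_exp_mul_exp_sub_le h)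

/-- With x = e^ζ the integrand becomes exp(κ e^ζ - βζ), which is entire; a rotation of the ray
becomes a vertical shift, handled by Cauchy's theorem on rectangles. The far side is O(e^{-βT})
because Re(κ e^{iθ}) ≤ 0 throughout the sector. -/
lemma integral_ray_sub_integral_ray {θ₁ θ₂ L : ℝ} (hβ : 0 < β) (hθ : θ₁ ≤ θ₂)
    (h : ∀ θ ∈ Set.Icc θ₁ θ₂, (κ * Complex.exp (θ * Complex.I)).re ≤ 0) :
    (∫ u in Set.Ioi L, Complex.exp (κ * Complex.exp (u + θ₁ * Complex.I) -
        β * (u + θ₁ * Complex.I))) -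
      ∫ u in Set.Ioi L, Complex.exp (κ * Complex.exp (u + θ₂ * Complex.I) -
        β * (u + θ₂ * Complex.I)) =
    Complex.I * ∫ θ in θ₁..θ₂, Complex.exp (κ * Complex.exp (L + θ * Complex.I) -
        β * (L + θ * Complex.I)) := by
  set f : ℂ → ℂ := fun ζ => Complex.exp (κ * Complex.exp ζ - β * ζ) with hf
  have hrect : ∀ T : ℝ, (∫ u in L..T, f (u + θ₁ * Complex.I)) -
      (∫ u in L..T, f (u + θ₂ * Complex.I)) + Complex.I * (∫ θ in θ₁..θ₂, f (T + θ * Complex.I)) -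
        Complex.I * (∫ θ in θ₁..θ₂, f (L + θ * Complex.I)) = 0 := by
    intro T
    have := Complex.integral_boundary_rect_eq_zero_of_differentiableOn f (L + θ₁ * Complex.I)
      (T + θ₂ * Complex.I) (by rw [hf]; fun_prop)
    simpa using this
  have h1 := intervalIntegral_tendsto_integral_Ioi L
    (integrableOn_exp_mul_exp_sub (L := L) hβ (h θ₁ ⟨le_rfl, hθ⟩)) Filter.tendsto_id
  have h2 := intervalIntegral_tendsto_integral_Ioi L
    (integrableOn_exp_mul_exp_sub (L := L) hβ (h θ₂ ⟨hθ, le_rfl⟩)) Filter.tendsto_id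
  have h3 : Filter.Tendsto (fun T : ℝ => ∫ θ in θ₁..θ₂, f (T + θ * Complex.I)) Filter.atTop
      (nhds 0) := by
    have hlim : Filter.Tendsto (fun T : ℝ => Real.exp (-β * T) * |θ₂ - θ₁|) Filter.atTop
        (nhds 0) := by
      have : Filter.Tendsto (fun T : ℝ => Real.exp (-β * T)) Filter.atTop (nhds 0) :=
        Real.tendsto_exp_atBot.comp (Filter.tendsto_id.const_mul_atTop_of_neg (by linarith))
      simpa using this.mul_const |θ₂ - θ₁|
    refine squeeze_zero_norm (fun T => ?_) hlim
    refine intervalIntegral.norm_integral_le_of_norm_le_const fun θ hθ' => ?_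
    rw [Set.uIoc_of_le hθ] at hθ'
    exact norm_exp_mul_exp_sub_le (h θ ⟨hθ'.1.le, hθ'.2⟩)
  have h4 := ((h1.sub h2).add (h3.const_mul Complex.I)).sub
    (tendsto_const_nhds (x := Complex.I * ∫ θ in θ₁..θ₂, f (L + θ * Complex.I)))
  have h5 := tendsto_nhds_unique (h4.congr fun T => hrect T) tendsto_const_nhds
  rw [mul_zero, add_zero] at h5
  exact sub_eq_zero.1 h5

lemma integral_ray_eq_rayIntegral {θ R : ℝ} (hβ : 0 < β) (hR : 0 < R)
    (h : (κ * Complex.exp (θ * Complex.I)).re ≤ 0) :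
    (∫ u in Set.Ioi (Real.log R), Complex.exp (κ * Complex.exp (u + θ * Complex.I) -
        β * (u + θ * Complex.I))) =
      Complex.exp (-(β * θ * Complex.I)) * rayIntegral β R (κ * Complex.exp (θ * Complex.I)) := by
  set g : ℝ → ℂ := fun x => Complex.exp (κ * Complex.exp (θ * Complex.I) * x) *
    ((x ^ (-β - 1) : ℝ) : ℂ) with hg
  have hcomp : ∀ u : ℝ, Complex.exp (κ * Complex.exp (u + θ * Complex.I) - β * (u + θ * Complex.I)) =
      Complex.exp (-(β * θ * Complex.I)) * (Real.exp u • (g ∘ Real.exp) u) := by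
    intro u
    simp only [hg, Function.comp_apply, Complex.real_smul]
    rw [Real.rpow_def_of_pos (Real.exp_pos u), Real.log_exp]
    push_cast
    rw [← Complex.exp_add, ← Complex.exp_add, ← Complex.exp_add, Complex.exp_add (u : ℂ)]
    congr 1
    ring
  have himg : Real.exp '' Set.Ici (Real.log R) ⊆ Set.Ici R := by
    rintro _ ⟨u, hu, rfl⟩
    exact (Real.log_le_iff_le_exp hR).1 hu
  simp_rw [hcomp]
  rw [integral_const_mul, integral_deriv_smul_comp_Ioi Real.continuous_exp.continuousOn
    Real.tendsto_exp_atTop (fun x _ => (Real.hasDerivAt_exp x).hasDerivWithinAt), Real.exp_log hR,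
    rayIntegral]
  · intro x hx
    obtain ⟨u, -, rfl⟩ := hx
    refine ContinuousAt.continuousWithinAt ?_
    refine ContinuousAt.mul (by fun_prop) (Complex.continuous_ofReal.continuousAt.comp
      (continuousAt_id.rpow_const (Or.inl (Real.exp_pos u).ne')))
  · exact ((integrableOn_Ici_iff_integrableOn_Ioi).2 (integrableOn_rayIntegral hβ hR h)).mono_set himg
  · rw [integrableOn_Ici_iff_integrableOn_Ioi]
    have := (integrableOn_exp_mul_exp_sub (L := Real.log R) hβ h)
    simp_rw [hcomp] at this
    have h2 := this.const_mul (Complex.exp (-(β * θ * Complex.I)))⁻¹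
    simpa [IntegrableOn, ← mul_assoc, Complex.exp_ne_zero] using h2

/-- The discrepancy between two rays lives on a compact arc, so expanding the exponential there
gives an entire series in κ. -/
lemma hasSum_arc {θ₁ θ₂ R : ℝ} (hR : 0 < R) :
    HasSum (fun n : ℕ => κ ^ n / (n.factorial : ℂ) *
        (((R ^ ((n : ℝ) - β) : ℝ) : ℂ) * arcIntegral θ₁ θ₂ (n - β)))
      (Complex.I * ∫ θ in θ₁..θ₂, Complex.exp (κ * Complex.exp (Real.log R + θ * Complex.I) -
        β * (Real.log R + θ * Complex.I))) := by
  have h := intervalIntegral.hasSum_integral_of_dominated_convergence (μ := volume)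
    (a := θ₁) (b := θ₂)
    (F := fun (n : ℕ) (θ : ℝ) => κ ^ n / (n.factorial : ℂ) * (((R ^ ((n : ℝ) - β) : ℝ) : ℂ) *
      Complex.exp ((θ * ((n : ℝ) - β) : ℝ) * Complex.I)))
    (f := fun θ : ℝ => Complex.exp (κ * Complex.exp (Real.log R + θ * Complex.I) -
        β * (Real.log R + θ * Complex.I)))
    (fun n _ => (‖κ‖ * R) ^ n / (n.factorial : ℝ) * R ^ (-β)) (fun n => by fun_prop)
    (fun n => Filter.Eventually.of_forall fun θ _ => ?_)
    (Filter.Eventually.of_forall fun θ _ =>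
      (Real.summable_pow_div_factorial (‖κ‖ * R)).mul_right _) (by simp)
    (Filter.Eventually.of_forall fun θ _ => ?_)
  · have h2 := h.mul_left Complex.I
    refine h2.of_eq (fun n => ?_) rfl
    rw [intervalIntegral.integral_const_mul, intervalIntegral.integral_const_mul, arcIntegral]
    ring
  · rw [norm_mul, norm_mul, Complex.norm_exp_ofReal_mul_I, norm_div, norm_pow, Complex.norm_natCast,
      Complex.norm_real, Real.norm_of_nonneg (by positivity), sub_eq_add_neg, Real.rpow_add hR,
      Real.rpow_natCast, mul_pow]
    exact le_of_eq (by ring)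
  · have h1 := (NormedSpace.expSeries_div_hasSum_exp
      (κ * Complex.exp (Real.log R + θ * Complex.I))).mul_right
      (Complex.exp (-(β * (Real.log R + θ * Complex.I))))
    rw [← Complex.exp_eq_exp_ℂ, ← Complex.exp_add, ← sub_eq_add_neg] at h1
    refine h1.of_eq (fun n => ?_) rfl
    rw [Real.rpow_def_of_pos hR, mul_pow, ← Complex.exp_nat_mul, Complex.ofReal_exp,
      ← Complex.exp_add, mul_div_right_comm, mul_assoc, ← Complex.exp_add]
    push_cast
    ring_nf

lemma hasSum_rayIntegral_sub {θ₁ θ₂ R : ℝ} (hβ : 0 < β) (hR : 0 < R) (hθ : θ₁ ≤ θ₂)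
    (h : ∀ θ ∈ Set.Icc θ₁ θ₂, (κ * Complex.exp (θ * Complex.I)).re ≤ 0) :
    HasSum (fun n : ℕ => κ ^ n / (n.factorial : ℂ) *
        (((R ^ ((n : ℝ) - β) : ℝ) : ℂ) * arcIntegral θ₁ θ₂ (n - β)))
      (Complex.exp (-(β * θ₁ * Complex.I)) * rayIntegral β R (κ * Complex.exp (θ₁ * Complex.I)) -
        Complex.exp (-(β * θ₂ * Complex.I)) *
          rayIntegral β R (κ * Complex.exp (θ₂ * Complex.I))) := by
  rw [← integral_ray_eq_rayIntegral hβ hR (h θ₁ ⟨le_rfl, hθ⟩),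
    ← integral_ray_eq_rayIntegral hβ hR (h θ₂ ⟨hθ, le_rfl⟩),
    integral_ray_sub_integral_ray hβ hθ h]
  exact hasSum_arc hR

end rotation

/-! ### Splitting |x| ≥ R into two half-lines. -/

lemma setOf_le_abs_eq (R : ℝ) : {x : ℝ | R ≤ |x|} = Set.Iic (-R) ∪ Set.Ici R := by
  ext x
  change R ≤ |x| ↔ x ≤ -R ∨ R ≤ x
  exact le_abs'

section split

variable {E : Type*} [NormedAddCommGroup E]

lemma integrableOn_le_abs_iff {f : ℝ → E} {R : ℝ} :
    IntegrableOn f {x | R ≤ |x|} ↔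
      IntegrableOn (fun x => f (-x)) (Set.Ioi R) ∧ IntegrableOn f (Set.Ioi R) := by
  rw [setOf_le_abs_eq, integrableOn_union, integrableOn_Ici_iff_integrableOn_Ioi,
    integrableOn_Iic_iff_integrableOn_Iio,
    ← (Measure.measurePreserving_neg (volume : Measure ℝ)).integrableOn_comp_preimage
      (MeasurableEquiv.neg ℝ).measurableEmbedding]
  simp [Function.comp_def]

lemma setIntegral_le_abs [NormedSpace ℝ E] {f : ℝ → E} {R : ℝ} (hR : 0 < R)
    (h : IntegrableOn f {x | R ≤ |x|}) :
    ∫ x in {x | R ≤ |x|}, f x = (∫ x in Set.Ioi R, f (-x)) + ∫ x in Set.Ioi R, f x := by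
  have hd : Disjoint (Set.Iic (-R)) (Set.Ici R) := by
    rw [Set.disjoint_left]
    intro x h1 h2
    rw [Set.mem_Iic] at h1
    rw [Set.mem_Ici] at h2
    linarith
  rw [setOf_le_abs_eq] at h ⊢
  rw [setIntegral_union hd measurableSet_Ici h.left_of_union h.right_of_union,
    integral_comp_neg_Ioi, integral_Ici_eq_integral_Ioi]

end split

lemma integrableOn_abs_rpow {R β : ℝ} (hR : 0 < R) (hβ : 0 < β) :
    IntegrableOn (fun x : ℝ => |x| ^ (-β - 1)) {x | R ≤ |x|} := by
  have h1 : IntegrableOn (fun x : ℝ => |x| ^ (-β - 1)) (Set.Ioi R) :=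
    (integrableOn_congr_fun (fun x hx => by
      rw [abs_of_pos (hR.trans hx)]) measurableSet_Ioi).2
      (integrableOn_Ioi_rpow_of_lt (by linarith : -β - 1 < -1) hR)
  exact integrableOn_le_abs_iff.2 ⟨by simpa using h1, h1⟩

lemma setIntegral_abs_rpow {R β : ℝ} (hR : 0 < R) (hβ : 0 < β) :
    ∫ x in {x : ℝ | R ≤ |x|}, |x| ^ (-β - 1) = 2 * R ^ (-β) / β := by
  have h1 : ∫ x in Set.Ioi R, |x| ^ (-β - 1) = R ^ (-β) / β := by
    rw [setIntegral_congr_fun measurableSet_Ioi (g := fun x => x ^ (-β - 1)) fun x hx => by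
      simp only [abs_of_pos (hR.trans hx)], integral_Ioi_rpow_of_lt (by linarith) hR]
    rw [sub_add_cancel, neg_div_neg_eq]
  rw [setIntegral_le_abs hR (integrableOn_abs_rpow hR hβ)]
  simp only [abs_neg, h1]
  ring

/-! ### Fourier integral of a single tail term. -/

section expansion

variable {β R : ℝ} (a : ℂ)

lemma norm_exp_mul_im_invPow_le (β z x : ℝ) :
    ‖Complex.exp (z * x * Complex.I) * ((a * invPow x (β + 1)).im : ℂ)‖ ≤
      ‖a‖ * |x| ^ (-β - 1) := by
  rw [norm_mul, show (z * x * Complex.I : ℂ) = ((z * x : ℝ) : ℂ) * Complex.I by push_cast; ring,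
    Complex.norm_exp_ofReal_mul_I, one_mul, Complex.norm_real, Real.norm_eq_abs]
  refine (Complex.abs_im_le_norm _).trans ?_
  rw [norm_mul, norm_invPow, neg_add']

lemma integrableOn_exp_mul_im_invPow (hβ : 0 < β) (hR : 0 < R) (z : ℝ) :
    IntegrableOn (fun x : ℝ => Complex.exp (z * x * Complex.I) *
      ((a * invPow x (β + 1)).im : ℂ)) {x | R ≤ |x|} := by
  refine Integrable.mono' ((integrableOn_abs_rpow hR hβ).const_mul ‖a‖) ?_
    (Filter.Eventually.of_forall fun x => norm_exp_mul_im_invPow_le a β z x)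
  refine ContinuousOn.aestronglyMeasurable (fun x hx => ?_) (measurableSet_le_abs R)
  have hx0 : x ≠ 0 := abs_pos.1 (hR.trans_le hx)
  refine ContinuousAt.continuousWithinAt (ContinuousAt.mul (by fun_prop) ?_)
  exact Complex.continuous_ofReal.continuousAt.comp (Complex.continuous_im.continuousAt.comp
      (continuousAt_const.mul (continuousAt_invPow hx0 _)))

lemma setIntegral_exp_mul_im_invPow (hβ : 0 < β) (hR : 0 < R) (z : ℝ) :
    ∫ x in {x : ℝ | R ≤ |x|}, Complex.exp (z * x * Complex.I) * ((a * invPow x (β + 1)).im : ℂ) =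
      a.im * rayIntegral β R (Complex.I * z) -
        (a * Complex.exp (Complex.I * β * Real.pi)).im * rayIntegral β R (-(Complex.I * z)) := by
  rw [setIntegral_le_abs hR (integrableOn_exp_mul_im_invPow a hβ hR z), rayIntegral, rayIntegral,
    ← integral_const_mul, ← integral_const_mul]
  have h1 : ∫ x in Set.Ioi R, Complex.exp (z * x * Complex.I) * ((a * invPow x (β + 1)).im : ℂ) =
      ∫ x in Set.Ioi R, a.im * (Complex.exp (Complex.I * z * x) * ((x ^ (-β - 1) : ℝ) : ℂ)) := by
    refine setIntegral_congr_fun measurableSet_Ioi fun x hx => ?_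
    have hx0 : 0 < x := hR.trans hx
    rw [invPow, if_pos hx0, Complex.im_mul_ofReal, neg_add']
    push_cast
    ring_nf
  have h2 : ∫ x in Set.Ioi R, Complex.exp (z * (-x : ℝ) * Complex.I) *
      ((a * invPow (-x) (β + 1)).im : ℂ) =
      -∫ x in Set.Ioi R, (a * Complex.exp (Complex.I * β * Real.pi)).im *
        (Complex.exp (-(Complex.I * z) * x) * ((x ^ (-β - 1) : ℝ) : ℂ)) := by
    rw [← integral_neg]
    refine setIntegral_congr_fun measurableSet_Ioi fun x hx => ?_
    have hx0 : 0 < x := hR.trans hx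
    have he : Complex.exp (Complex.I * ((β + 1 : ℝ) : ℂ) * Real.pi) =
        -Complex.exp (Complex.I * β * Real.pi) := by
      rw [show Complex.I * ((β + 1 : ℝ) : ℂ) * Real.pi = Complex.I * β * Real.pi +
        Real.pi * Complex.I by push_cast; ring, Complex.exp_add, Complex.exp_pi_mul_I]
      ring
    rw [invPow, if_neg (by linarith), abs_neg, abs_of_pos hx0, ← mul_assoc, Complex.im_mul_ofReal,
      he, mul_neg, Complex.neg_im, neg_add']
    push_cast
    ring_nf
  rw [h1, h2]
  ring

/-- Rotation through the upper half-circle, where Re(iz e^{iθ}) = -z sin θ ≤ 0; it expresses both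
oscillating rays through one of them. -/
lemma hasSum_rayIntegral_I (hβ : 0 < β) (hR : 0 < R) {z : ℝ} (hz : 0 ≤ z) :
    HasSum (fun n : ℕ => (Complex.I * z) ^ n / (n.factorial : ℂ) *
        (((R ^ ((n : ℝ) - β) : ℝ) : ℂ) * arcIntegral 0 Real.pi (n - β)))
      (rayIntegral β R (Complex.I * z) - Complex.exp (-(Complex.I * β * Real.pi)) *
          rayIntegral β R (-(Complex.I * z))) := by
  refine (hasSum_rayIntegral_sub (κ := Complex.I * z) hβ hR Real.pi_pos.le fun θ hθ => ?_).of_eq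
    (fun _ => rfl) ?_
  · rw [Complex.exp_mul_I, ← Complex.ofReal_cos, ← Complex.ofReal_sin]
    have := Real.sin_nonneg_of_nonneg_of_le_pi hθ.1 hθ.2
    rw [← Complex.sin_ofReal_re] at this
    simpa using mul_nonneg hz this
  · rw [Complex.exp_pi_mul_I]
    simp only [Complex.ofReal_zero, zero_mul, mul_zero, neg_zero, Complex.exp_zero, mul_one, one_mul,
      mul_neg]
    ring_nf

/-- A quarter turn carries the remaining oscillating ray to the decaying one, an incomplete Gamma
integral. -/
lemma hasSum_rayIntegral_neg_I (hβ : 0 < β) (hR : 0 < R) {z : ℝ} (hz : 0 ≤ z) :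
    HasSum (fun n : ℕ => (-(Complex.I * z)) ^ n / (n.factorial : ℂ) *
        (((R ^ ((n : ℝ) - β) : ℝ) : ℂ) * arcIntegral (-(Real.pi / 2)) 0 (n - β)))
      (Complex.exp (Complex.I * β * (Real.pi / 2)) * rayIntegral β R (-z) -
          rayIntegral β R (-(Complex.I * z))) := by
  refine (hasSum_rayIntegral_sub (κ := -(Complex.I * z)) hβ hR
    (by linarith [Real.pi_pos]) fun θ hθ => ?_).of_eq (fun _ => rfl) ?_
  · rw [Complex.exp_mul_I, ← Complex.ofReal_cos, ← Complex.ofReal_sin]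
    have := Real.sin_nonpos_of_nonpos_of_neg_pi_le hθ.2 (by linarith [hθ.1, Real.pi_pos])
    rw [← Complex.sin_ofReal_re] at this
    simpa using mul_nonpos_of_nonneg_of_nonpos hz this
  · have : Complex.exp (((-(Real.pi / 2) : ℝ) : ℂ) * Complex.I) = -Complex.I := by
      push_cast
      rw [neg_mul, Complex.exp_neg, Complex.exp_pi_div_two_mul_I, Complex.inv_I]
    rw [this, show -(Complex.I * z) * -Complex.I = -(z : ℂ) by
      linear_combination (z : ℂ) * Complex.I_mul_I]
    simp only [Complex.ofReal_zero, zero_mul, mul_zero, neg_zero, Complex.exp_zero, mul_one, one_mul]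
    push_cast
    ring_nf

lemma rayIntegral_neg_ofReal (s : ℝ) : rayIntegral β R (-s) =
    ((∫ x in Set.Ioi R, Real.exp (-s * x) * x ^ (-β - 1) : ℝ) : ℂ) := by
  rw [rayIntegral, ← integral_complex_ofReal]
  push_cast
  rfl

/-- |sin(πβ)| = |sin(π(n-β))| ≤ π|n-β|. This makes the coefficients uniformly bounded however close
β is to an integer; at β = n the quotient is 0 by convention. -/
lemma abs_sin_div_le (β : ℝ) (n : ℕ) : |Real.sin (Real.pi * β) / (n - β)| ≤ Real.pi := by
  have h1 : |Real.sin (Real.pi * β)| = |Real.sin (Real.pi * (n - β))| := by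
    rw [mul_sub, mul_comm Real.pi (n : ℝ), Real.sin_nat_mul_pi_sub, abs_neg, abs_mul, abs_pow,
      abs_neg, abs_one, one_pow, one_mul]
  rw [abs_div, h1]
  refine div_le_of_le_mul₀ (abs_nonneg _) Real.pi_pos.le ?_
  refine Real.abs_sin_le_abs.trans ?_
  rw [abs_mul, abs_of_pos Real.pi_pos]

/-- For `z > 0`, the Fourier integral of `Im (a (1 / x) ^ (β + 1))` over `{|x| ≥ R}` is a multiple of
`(i z) ^ β / Γ (β + 1)` plus an entire function of exponential type. -/
lemma exists_hasSum_fourier_im_invPow (hβ : 0 < β) (hR : 0 < R) :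
    ∃ (k : ℂ) (e : ℕ → ℂ), ‖k‖ ≤ Real.pi * ‖a‖ ∧
      (∀ n : ℕ, ‖e n‖ ≤ 3 * Real.pi * ‖a‖ * R ^ ((n : ℝ) - β)) ∧
      ∀ z : ℝ, 0 < z → HasSum (fun n : ℕ => (Complex.I * z) ^ n / (n.factorial : ℂ) * e n)
        ((∫ x in {x : ℝ | R ≤ |x|}, Complex.exp (z * x * Complex.I) *
            ((a * invPow x (β + 1)).im : ℂ)) -
          k / (Real.Gamma (β + 1) : ℂ) * Complex.I ^ (β : ℂ) * (z : ℂ) ^ (β : ℂ)) := by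
  set sn : ℝ := Real.sin (Real.pi * β) with hsn
  set ph : ℂ := Complex.exp (Complex.I * β * (Real.pi / 2)) with hph
  have hphn : ‖ph‖ = 1 := by
    rw [hph, show Complex.I * β * (Real.pi / 2) = ((β * (Real.pi / 2) : ℝ) : ℂ) * Complex.I by
      push_cast; ring, Complex.norm_exp_ofReal_mul_I]
  have hIpow : Complex.I ^ (β : ℂ) = ph := by
    rw [Complex.cpow_def_of_ne_zero Complex.I_ne_zero, Complex.log_I, hph]
    ring_nf
  have hGamma : (∀ n : ℕ, β ≠ n) → sn * Real.Gamma (-β) = -Real.pi / Real.Gamma (β + 1) := by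
    intro hn
    have h1 := Real.Gamma_mul_Gamma_one_sub (-β)
    have h2 : Real.Gamma (β + 1) ≠ 0 := (Real.Gamma_pos_of_pos (by linarith)).ne'
    have h3 : sn ≠ 0 := by
      rw [hsn, Real.sin_ne_zero_iff]
      intro k hk
      have hk' : (k : ℝ) = β := by
        rw [mul_comm] at hk
        exact mul_left_cancel₀ Real.pi_ne_zero hk
      have hk0 : 0 ≤ k := by
        have : (0 : ℝ) < k := hk' ▸ hβ
        exact_mod_cast this.le
      obtain ⟨n, rfl⟩ := Int.eq_ofNat_of_zero_le hk0
      exact hn n (by simpa using hk'.symm)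
    rw [sub_neg_eq_add, add_comm (1 : ℝ), mul_neg, Real.sin_neg, ← hsn] at h1
    rw [eq_div_iff h2, mul_assoc, h1]
    field_simp
  -- the imaginary part identity behind the cancellation of the two rays
  have him : (a.im : ℂ) * Complex.exp (-(Complex.I * β * Real.pi)) -
      (a * Complex.exp (Complex.I * β * Real.pi)).im = -(a * sn) := by
    have e1 : Complex.exp (Complex.I * β * Real.pi) =
        ((Real.cos (Real.pi * β) : ℝ) : ℂ) + (sn : ℂ) * Complex.I := by
      rw [show Complex.I * β * Real.pi = ((Real.pi * β : ℝ) : ℂ) * Complex.I by push_cast; ring,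
        Complex.exp_mul_I, ← Complex.ofReal_cos, ← Complex.ofReal_sin]
    have e2 : Complex.exp (-(Complex.I * β * Real.pi)) =
        ((Real.cos (Real.pi * β) : ℝ) : ℂ) - (sn : ℂ) * Complex.I := by
      rw [show -(Complex.I * β * Real.pi) = ((-(Real.pi * β) : ℝ) : ℂ) * Complex.I by
        push_cast; ring, Complex.exp_mul_I, ← Complex.ofReal_cos, ← Complex.ofReal_sin, Real.cos_neg,
        Real.sin_neg, ← hsn]
      push_cast; ring
    rw [e1, e2]
    generalize Real.cos (Real.pi * β) = cs
    apply Complex.ext <;> simp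
  have hray : ∃ k : ℂ, ‖k‖ ≤ Real.pi * ‖a‖ ∧ ∀ z : ℝ, 0 < z → HasSum (fun n : ℕ =>
      (Complex.I * z) ^ n / (n.factorial : ℂ) * (a * ph * Complex.I ^ n *
        ((sn / (n - β) : ℝ) : ℂ) * ((R ^ ((n : ℝ) - β) : ℝ) : ℂ)))
      (-(a * sn * (ph * rayIntegral β R (-z))) -
        k / (Real.Gamma (β + 1) : ℂ) * Complex.I ^ (β : ℂ) * (z : ℂ) ^ (β : ℂ)) := by
    by_cases hn : ∀ n : ℕ, β ≠ n
    · refine ⟨Real.pi * a, ?_, fun z hz => ?_⟩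
      · rw [norm_mul, Complex.norm_real, Real.norm_of_nonneg Real.pi_pos.le]
      · have h := ((Complex.hasSum_ofReal.2 (hasSum_incompleteGamma hz hR hn)).mul_left
          (a * ph * sn))
        refine h.of_eq (fun n => ?_) ?_
        -- Since -z = (iz)·i, the series in -z is rewritten in powers of iz, at the cost of the
        -- factors i^n.
        · have : (-z : ℂ) ^ n = (Complex.I * z) ^ n * Complex.I ^ n := by
            rw [← mul_pow]
            congr 1
            linear_combination (-(z : ℂ)) * Complex.I_mul_I
          push_cast
          rw [this]
          ring
        · have hG : (sn : ℂ) * Real.Gamma (-β) = -Real.pi / Real.Gamma (β + 1) := by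
            exact_mod_cast congrArg (fun t : ℝ => (t : ℂ)) (hGamma hn)
          rw [rayIntegral_neg_ofReal, hIpow, ← Complex.ofReal_cpow hz.le]
          push_cast
          linear_combination (a * ph * ((z ^ β : ℝ) : ℂ)) * hG
    · push Not at hn
      obtain ⟨j, hj⟩ := hn
      -- For integer β the sine vanishes and with it the whole contribution, including the
      -- coefficient at n = β, read as 0/0 = 0; hence k = 0.
      have h0 : sn = 0 := by
        rw [hsn, hj, mul_comm, Real.sin_nat_mul_pi]
      refine ⟨0, by simpa using mul_nonneg Real.pi_pos.le (norm_nonneg a), fun z hz => ?_⟩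
      simp [h0, hasSum_zero]
  obtain ⟨k, hk, hsum⟩ := hray
  -- The three summands come from the half-circle, the incomplete Gamma series and the
  -- quarter-circle; each has norm at most π‖a‖.
  refine ⟨k, fun n => ((R ^ ((n : ℝ) - β) : ℝ) : ℂ) * (a.im * arcIntegral 0 Real.pi (n - β) +
    a * ph * Complex.I ^ n * ((sn / (n - β) : ℝ) : ℂ) +
    a * sn * (-1) ^ n * arcIntegral (-(Real.pi / 2)) 0 (n - β)), hk, fun n => ?_, fun z hz => ?_⟩
  · have hRn : 0 ≤ R ^ ((n : ℝ) - β) := by positivity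
    rw [norm_mul, Complex.norm_real, Real.norm_of_nonneg hRn, mul_comm]
    refine mul_le_mul_of_nonneg_right ?_ hRn
    have ha := norm_nonneg a
    have hpi := Real.pi_pos
    have b1 : ‖(a.im : ℂ) * arcIntegral 0 Real.pi (n - β)‖ ≤ ‖a‖ * Real.pi := by
      rw [norm_mul, Complex.norm_real]
      have := norm_arcIntegral_le hpi.le ((n : ℝ) - β)
      rw [sub_zero] at this
      exact mul_le_mul (Complex.abs_im_le_norm a) this (norm_nonneg _) ha
    have b2 : ‖a * ph * Complex.I ^ n * ((sn / (n - β) : ℝ) : ℂ)‖ ≤ ‖a‖ * Real.pi := by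
      rw [norm_mul, norm_mul, norm_mul, hphn, norm_pow, Complex.norm_I, one_pow, mul_one, mul_one,
        Complex.norm_real]
      exact mul_le_mul_of_nonneg_left (abs_sin_div_le β n) ha
    have b3 : ‖a * sn * (-1) ^ n * arcIntegral (-(Real.pi / 2)) 0 (n - β)‖ ≤ ‖a‖ * Real.pi := by
      rw [norm_mul, norm_mul, norm_mul, norm_pow, norm_neg, norm_one, one_pow, mul_one,
        Complex.norm_real]
      have h1 := norm_arcIntegral_le (θ₁ := -(Real.pi / 2)) (θ₂ := 0) (by linarith) ((n : ℝ) - β)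
      have h2 : ‖sn‖ ≤ 1 := Real.abs_sin_le_one _
      calc ‖a‖ * ‖sn‖ * ‖arcIntegral (-(Real.pi / 2)) 0 (n - β)‖
          ≤ ‖a‖ * 1 * (0 - -(Real.pi / 2)) := by gcongr
        _ ≤ ‖a‖ * Real.pi := by nlinarith
    refine (norm_add₃_le.trans (add_le_add (add_le_add b1 b2) b3)).trans (le_of_eq ?_)
    ring
  · have h1 := (hasSum_rayIntegral_I hβ hR hz.le).mul_left (a.im : ℂ)
    have h2 := (hasSum_rayIntegral_neg_I hβ hR hz.le).mul_left (a * sn : ℂ)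
    refine ((h1.add (hsum z hz)).add h2).of_eq (fun n => ?_) ?_
    · rw [neg_pow (Complex.I * z)]
      ring
    · rw [setIntegral_exp_mul_im_invPow a hβ hR]
      linear_combination (-rayIntegral β R (-(Complex.I * z))) * him

end expansion

/-! ### The central part of the measure and the exchange of sums. -/

lemma hasSum_setIntegral_exp_of_abs_lt (μ : Measure ℝ) [IsFiniteMeasure μ] (R z : ℝ) :
    HasSum (fun n : ℕ => (Complex.I * z) ^ n / (n.factorial : ℂ) *
        ∫ x in {x : ℝ | R ≤ |x|}ᶜ, (x : ℂ) ^ n ∂μ)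
      (∫ x in {x : ℝ | R ≤ |x|}ᶜ, Complex.exp (z * x * Complex.I) ∂μ) := by
  have hD : MeasurableSet {x : ℝ | R ≤ |x|}ᶜ := (measurableSet_le_abs R).compl
  simp_rw [← integral_const_mul]
  refine hasSum_integral_of_dominated_convergence
    (fun n _ => (|z| * R) ^ n / (n.factorial : ℝ)) (fun n => by fun_prop) (fun n => ?_)
    (Filter.Eventually.of_forall fun x => Real.summable_pow_div_factorial _)
    (integrable_const _) (Filter.Eventually.of_forall fun x => ?_)
  · filter_upwards [ae_restrict_mem hD] with x hx
    have hx' : |x| ≤ R := le_of_not_ge hx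
    rw [norm_mul, norm_div, norm_pow, norm_mul, Complex.norm_I, one_mul, Complex.norm_real,
      Complex.norm_natCast, norm_pow, Complex.norm_real, Real.norm_eq_abs, Real.norm_eq_abs, mul_pow,
      mul_div_right_comm]
    gcongr
  · have h := NormedSpace.expSeries_div_hasSum_exp (z * x * Complex.I)
    rw [← Complex.exp_eq_exp_ℂ] at h
    refine h.of_eq (fun n => ?_) rfl
    rw [show (z * x * Complex.I : ℂ) = Complex.I * z * x by ring, mul_pow _ (x : ℂ)]
    ring

lemma norm_setIntegral_pow_le (μ : Measure ℝ) [IsProbabilityMeasure μ] {R : ℝ} (hR : 0 ≤ R) (n : ℕ) :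
    ‖∫ x in {x : ℝ | R ≤ |x|}ᶜ, (x : ℂ) ^ n ∂μ‖ ≤ R ^ n := by
  refine (norm_setIntegral_le_of_norm_le_const (C := R ^ n) (measure_lt_top _ _) fun x hx => ?_).trans
    (mul_le_of_le_one_right (by positivity) measureReal_le_one)
  have hx' : |x| ≤ R := le_of_not_ge hx
  rw [norm_pow, Complex.norm_real, Real.norm_eq_abs]
  gcongr

/-- The bound b_i R^n makes the double series absolutely summable; summing it in the two orders
yields the collected entire part X and the sum of the fractional terms κ. -/
lemma hasSum_swap_entire {ι : Type*} {G κ : ι → ℂ} {e : ι → ℕ → ℂ} {b : ι → ℝ} {R z : ℝ} {T : ℂ}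
    (hR : 0 ≤ R) (hb : Summable b) (he : ∀ i n, ‖e i n‖ ≤ b i * R ^ n)
    (hG : ∀ i, HasSum (fun n : ℕ => (Complex.I * z) ^ n / (n.factorial : ℂ) * e i n) (G i - κ i))
    (hT : HasSum G T) :
    ∃ X, HasSum (fun n : ℕ => (Complex.I * z) ^ n / (n.factorial : ℂ) * ∑' i, e i n) X ∧
      HasSum κ (T - X) := by
  have hb0 : ∀ i, 0 ≤ b i := fun i => by simpa using (norm_nonneg _).trans (he i 0)
  let f : ι × ℕ → ℂ := fun p => (Complex.I * z) ^ p.2 / (p.2.factorial : ℂ) * e p.1 p.2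
  have hs : Summable f := by
    refine Summable.of_norm_bounded (hb.mul_of_nonneg (Real.summable_pow_div_factorial (|z| * R))
      hb0 fun n => by positivity) fun p => ?_
    simp only [f]
    rw [norm_mul, norm_div, norm_pow, norm_mul, Complex.norm_I, one_mul, Complex.norm_real,
      Complex.norm_natCast, Real.norm_eq_abs, mul_pow]
    calc |z| ^ p.2 / (p.2.factorial : ℝ) * ‖e p.1 p.2‖
        ≤ |z| ^ p.2 / (p.2.factorial : ℝ) * (b p.1 * R ^ p.2) := by
          gcongr
          exact he _ _
      _ = _ := by ring
  obtain ⟨X, hX⟩ := hs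
  refine ⟨X, ?_, ?_⟩
  · have h1 : HasSum (f ∘ Equiv.prodComm ℕ ι) X := (Equiv.prodComm ℕ ι).hasSum_iff.2 hX
    have h2 : ∀ n, HasSum (fun i => e i n) (∑' i, e i n) := fun n =>
      (Summable.of_norm_bounded (hb.mul_right (R ^ n)) fun i => he i n).hasSum
    refine h1.prod_fiberwise fun n => ?_
    exact (h2 n).mul_left ((Complex.I * z) ^ n / (n.factorial : ℂ))
  · have h2 := hX.prod_fiberwise hG
    simpa using hT.sub h2

/-! ### From the tail density to the Fourier series. -/

section forward

variable {S : AddSubsemigroup ℝ} {c : ℝ} {a m : ℝ → ℂ} {r R : ℝ}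

/-- Termwise integration: the L¹ norm of the β-term is at most 2(r/R)^β/β, and 1/β ≤ 1/δ for the
lower bound δ of the positive exponents. -/
lemma hasSum_setIntegral_tailDensity (hS : IsExponentSet S c) (hr : 0 < r) (hR : 0 < R)
    (hrR : c * (r / R) < 1) (ha : ∀ β ∈ S, 0 < β → ‖a β‖ ≤ r ^ β) (z : ℝ) :
    HasSum (fun β : {β : ℝ // β ∈ S ∧ 0 < β} => ∫ x in {x : ℝ | R ≤ |x|},
        Complex.exp (z * x * Complex.I) * ((a β * invPow x (β + 1)).im : ℂ))
      (∫ x in {x : ℝ | R ≤ |x|}, Complex.exp (z * x * Complex.I) * (tailDensity S a x : ℂ)) := by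
  have := hS.countable_pos
  obtain ⟨δ, hδ, -, hδS⟩ := hS.exists_pos_le
  have h := hasSum_integral_of_summable_integral_norm
    (F := fun (β : {β : ℝ // β ∈ S ∧ 0 < β}) (x : ℝ) =>
      Complex.exp (z * x * Complex.I) * ((a β * invPow x (β + 1)).im : ℂ))
    (fun β => integrableOn_exp_mul_im_invPow (a β) β.2.2 hR z)
    (Summable.of_nonneg_of_le (fun β => integral_nonneg fun x => norm_nonneg _) (fun β => ?_)
      ((hS.summable_pos_rpow (div_pos hr hR) hrR).mul_left (2 / δ)))
  · refine h.of_eq (fun _ => rfl) ?_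
    refine integral_congr_ae (Filter.Eventually.of_forall fun x => ?_)
    simp only
    rw [tsum_mul_left, tailDensity, Complex.ofReal_tsum]
  · have hβ := β.2.2
    calc ∫ x in {x : ℝ | R ≤ |x|},
          ‖Complex.exp (z * x * Complex.I) * ((a β * invPow x (β + 1)).im : ℂ)‖
        ≤ ∫ x in {x : ℝ | R ≤ |x|}, ‖a β‖ * |x| ^ (-(β : ℝ) - 1) :=
          integral_mono (integrableOn_exp_mul_im_invPow (a β) hβ hR z).norm
            ((integrableOn_abs_rpow hR hβ).const_mul _)
            fun x => norm_exp_mul_im_invPow_le (a β) β z x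
      _ = ‖a β‖ * (2 * R ^ (-(β : ℝ)) / β) := by
          rw [integral_const_mul, setIntegral_abs_rpow hR hβ]
      _ ≤ r ^ (β : ℝ) * (2 * R ^ (-(β : ℝ)) / δ) := by
          gcongr
          · exact ha β β.2.1 hβ
          · exact hδS β β.2.1 hβ
      _ = 2 / δ * (r / R) ^ (β : ℝ) := by
          rw [Real.div_rpow hr.le hR.le, Real.rpow_neg hR.le]
          ring

/-- Let z → 0+: for z < 1 the terms are dominated by those at z = 1, and only γ = 0 survives, while
the characteristic function tends to 1. -/
lemma coeff_zero_eq_one (hS : IsExponentSet S c) {μ : Measure ℝ} [IsProbabilityMeasure μ]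
    (hF : ∀ z : ℝ, 0 < z → HasSum
      (fun γ : S => m γ / (Real.Gamma (γ + 1) : ℂ) * Complex.I ^ ((γ : ℝ) : ℂ) *
        (z : ℂ) ^ ((γ : ℝ) : ℂ)) (charFun μ z)) : m 0 = 1 := by
  set f : ℝ → S → ℂ := fun z γ => m γ / (Real.Gamma (γ + 1) : ℂ) * Complex.I ^ ((γ : ℝ) : ℂ) *
        (z : ℂ) ^ ((γ : ℝ) : ℂ) with hf
  have h0S : (0 : ℝ) ∈ S := by simpa using hS.natCast_mem 0
  have h1 : Filter.Tendsto (fun z => ∑' γ, f z γ) (nhdsWithin 0 (Set.Ioi 0))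
      (nhds (∑' γ : S, if γ = ⟨0, h0S⟩ then m 0 else 0)) := by
    refine tendsto_tsum_of_dominated_convergence (bound := fun γ => ‖f 1 γ‖)
      (hF 1 one_pos).summable.norm (fun γ => ?_) ?_
    · split_ifs with h
      · subst h
        simp [hf]
      · have hγ : (0 : ℝ) < γ := (hS.nonneg γ γ.2).lt_of_ne fun h' => h (Subtype.ext h'.symm)
        have hz : ContinuousAt (fun z : ℝ => f z γ) 0 := by
          refine continuousAt_const.mul ?_
          exact (Complex.continuousAt_ofReal_cpow_const 0 _ (Or.inl (by simpa using hγ)))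
        have h2 := hz.tendsto.mono_left (nhdsWithin_le_nhds (s := Set.Ioi 0))
        have h3 : f 0 γ = 0 := by
          simp [hf, hγ.ne']
        rwa [h3] at h2
    · filter_upwards [self_mem_nhdsWithin, nhdsWithin_le_nhds (Iio_mem_nhds one_pos)] with z hz hz1 γ
      have hz0 : (0 : ℝ) < z := hz
      have hz1' : z ≤ 1 := le_of_lt hz1
      simp only [hf]
      rw [norm_mul _ ((z : ℂ) ^ _), norm_mul _ (((1 : ℝ) : ℂ) ^ _),
        Complex.norm_cpow_eq_rpow_re_of_pos hz0, Complex.norm_cpow_eq_rpow_re_of_pos one_pos,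
        Complex.ofReal_re, Real.one_rpow]
      gcongr
      exact Real.rpow_le_one hz0.le hz1' (hS.nonneg γ γ.2)
  rw [tsum_ite_eq] at h1
  have h2 : Filter.Tendsto (fun z => ∑' γ, f z γ) (nhdsWithin 0 (Set.Ioi 0)) (nhds 1) := by
    have h3 : Filter.Tendsto (charFun μ) (nhdsWithin 0 (Set.Ioi 0)) (nhds (charFun μ 0)) :=
      (continuous_charFun.tendsto 0).mono_left nhdsWithin_le_nhds
    rw [charFun_zero] at h3
    simp only [probReal_univ, Complex.ofReal_one] at h3
    refine h3.congr' ?_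
    filter_upwards [self_mem_nhdsWithin] with z hz
    exact (hF z hz).tsum_eq.symm
  exact tendsto_nhds_unique h1 h2

theorem MemPS.exists_hasSum_charFun (hS : IsExponentSet S c) {μ : Measure ℝ}
    [IsProbabilityMeasure μ] (hμ : MemPS S c μ) :
    ∃ (m : ℝ → ℂ) (A : ℝ), 0 < A ∧ (∀ γ ∈ S, 0 < γ → ‖m γ‖ ≤ A ^ γ) ∧
      ∀ z : ℝ, 0 < z → HasSum
        (fun γ : S => m γ / (Real.Gamma (γ + 1) : ℂ) * Complex.I ^ ((γ : ℝ) : ℂ) *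
          (z : ℂ) ^ ((γ : ℝ) : ℂ)) (charFun μ z) := by
  classical
  obtain ⟨a, r, R, hr, hR, ha, hrR, hnn, hμR⟩ := hμ
  have hcr : c * (r / R) < 1 := by
    rw [inv_mul_eq_div, lt_div_iff₀ hS.const_pos] at hrR
    rw [← mul_div_assoc, div_lt_one hR]
    linarith
  have hrR' : r ≤ R := by
    have : r / R ≤ 1 := by nlinarith [hS.one_le_const, div_pos hr hR]
    rwa [div_le_one hR] at this
  have hD := measurableSet_le_abs R
  set P := {β : ℝ // β ∈ S ∧ 0 < β} with hP
  choose k e hk he hke using fun β : P => exists_hasSum_fourier_im_invPow (a β) β.2.2 hR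
  set b : P → ℝ := fun β => 3 * Real.pi * (r / R) ^ (β : ℝ) with hb
  have hbs : Summable b := (hS.summable_pos_rpow (div_pos hr hR) hcr).mul_left _
  have heb : ∀ β n, ‖e β n‖ ≤ b β * R ^ n := fun β n => by
    refine (he β n).trans ?_
    rw [Real.rpow_sub hR, Real.rpow_natCast, hb]
    simp only
    rw [Real.div_rpow hr.le hR.le]
    calc 3 * Real.pi * ‖a β‖ * (R ^ n / R ^ (β : ℝ))
        ≤ 3 * Real.pi * r ^ (β : ℝ) * (R ^ n / R ^ (β : ℝ)) := by
          have := Real.pi_pos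
          gcongr
          exact ha β β.2.1 β.2.2
      _ = _ := by ring
  set M : ℕ → ℂ := fun n => ∫ x in {x : ℝ | R ≤ |x|}ᶜ, (x : ℂ) ^ n ∂μ with hM
  set W : ℕ → ℂ := fun n => M n + ∑' β, e β n with hW
  have hWn : ∀ n, ‖W n‖ ≤ (1 + ∑' β, b β) * R ^ n := fun n => by
    have h1 : ‖∑' β, e β n‖ ≤ (∑' β, b β) * R ^ n :=
      tsum_of_norm_bounded (hbs.hasSum.mul_right _) fun β => heb β n
    have h2 := norm_setIntegral_pow_le μ hR.le n
    calc ‖W n‖ ≤ ‖M n‖ + ‖∑' β, e β n‖ := norm_add_le _ _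
      _ ≤ R ^ n + (∑' β, b β) * R ^ n := add_le_add h2 h1
      _ = _ := by ring
  -- The coefficient at γ is the singular one from the tail term of the same exponent, plus, when γ
  -- is a natural number, the collected entire coefficient.
  set k' : ℝ → ℂ := fun γ => if h : γ ∈ S ∧ 0 < γ then k ⟨γ, h⟩ else 0 with hk'
  set W' : ℝ → ℂ := fun γ => if γ = ⌊γ⌋₊ then W ⌊γ⌋₊ else 0 with hW'
  -- The constant adds the bound π for the singular coefficients, 1 for the central moments and ∑ b
  -- for the entire parts of the tail, all relative to R^γ.
  obtain ⟨A, hA, hAS⟩ := hS.exists_mul_rpow_le (Real.pi + (1 + ∑' β, b β)) R hR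
  have hb0 : 0 ≤ ∑' β, b β := tsum_nonneg fun β => by
    have := Real.pi_pos
    positivity
  refine ⟨fun γ => k' γ + W' γ, A, hA, fun γ hγ h0 => ?_, fun z hz => ?_⟩
  · refine le_trans ?_ (hAS γ hγ h0)
    have h1 : ‖k' γ‖ ≤ Real.pi * R ^ γ := by
      simp only [hk', dif_pos (show γ ∈ S ∧ 0 < γ from ⟨hγ, h0⟩)]
      refine (hk _).trans (mul_le_mul_of_nonneg_left ((ha γ hγ h0).trans ?_) Real.pi_pos.le)
      exact Real.rpow_le_rpow hr.le hrR' h0.le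
    have h2 : ‖W' γ‖ ≤ (1 + ∑' β, b β) * R ^ γ := by
      simp only [hW']
      split_ifs with h
      · refine (hWn _).trans (le_of_eq ?_)
        rw [← Real.rpow_natCast, ← h]
      · rw [norm_zero]; positivity
    calc ‖k' γ + W' γ‖ ≤ ‖k' γ‖ + ‖W' γ‖ := norm_add_le _ _
      _ ≤ _ := by rw [add_mul]; exact add_le_add h1 h2
  · have hT := hasSum_setIntegral_tailDensity hS hr hR hcr ha z
    obtain ⟨X, hX, hκ⟩ := hasSum_swap_entire hR.le hbs heb (fun β => hke β z hz) hT
    have htail : ∫ x in {x : ℝ | R ≤ |x|}, Complex.exp (z * x * Complex.I) ∂μ =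
        ∫ x in {x : ℝ | R ≤ |x|}, Complex.exp (z * x * Complex.I) * (tailDensity S a x : ℂ) := by
      have hmeas : AEMeasurable (fun x => ENNReal.ofReal (tailDensity S a x))
          (volume.restrict {x : ℝ | R ≤ |x|}) :=
        ((continuousOn_tailDensity hS hr hR hcr ha).aemeasurable hD).ennreal_ofReal
      rw [hμR, integral_withDensity_eq_integral_toReal_smul₀ hmeas
        (Filter.Eventually.of_forall fun x => ENNReal.ofReal_lt_top)]
      refine integral_congr_ae ?_
      filter_upwards [hnn] with x hx
      rw [ENNReal.toReal_ofReal hx, Complex.real_smul, mul_comm]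
    have hint : Integrable (fun x : ℝ => Complex.exp (z * x * Complex.I)) μ := by
      refine Integrable.of_bound (C := 1) (by fun_prop) (Filter.Eventually.of_forall fun x => ?_)
      rw [show (z * x * Complex.I : ℂ) = ((z * x : ℝ) : ℂ) * Complex.I by push_cast; ring,
        Complex.norm_exp_ofReal_mul_I]
    have hchar : charFun μ z = (∫ x in {x : ℝ | R ≤ |x|}ᶜ, Complex.exp (z * x * Complex.I) ∂μ) +
        ∫ x in {x : ℝ | R ≤ |x|}, Complex.exp (z * x * Complex.I) * (tailDensity S a x : ℂ) := by
      rw [charFun_apply_real, ← integral_add_compl hD hint, htail, add_comm]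
    have hWsum := (hasSum_setIntegral_exp_of_abs_lt μ R z).add hX
    set t : ℝ → ℂ := fun γ => Complex.I ^ (γ : ℂ) * (z : ℂ) ^ (γ : ℂ) with ht
    have hfrac : HasSum (fun γ : S => k' γ / (Real.Gamma (γ + 1) : ℂ) * t γ)
        ((∫ x in {x : ℝ | R ≤ |x|}, Complex.exp (z * x * Complex.I) * (tailDensity S a x : ℂ)) -
          X) := by
      refine (hS.hasSum_pos_iff (f := fun γ : ℝ => k' γ / (Real.Gamma (γ + 1) : ℂ) * t γ) ?_).1
        (hκ.of_eq (fun β => ?_) rfl)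
      · simp [hk']
      · simp only [hk', dif_pos β.2, ht]
        ring
    have hent : HasSum (fun γ : S => W' γ / (Real.Gamma (γ + 1) : ℂ) * t γ)
        ((∫ x in {x : ℝ | R ≤ |x|}ᶜ, Complex.exp (z * x * Complex.I) ∂μ) + X) := by
      let i : ℕ → S := fun n => ⟨n, hS.natCast_mem n⟩
      have hi : Function.Injective i := fun n n' h =>
        Nat.cast_injective (congrArg (fun z : S => (z : ℝ)) h)
      refine (hi.hasSum_iff fun γ hγ => ?_).1 (hWsum.of_eq (fun n => ?_) rfl)
      · have : (γ : ℝ) ≠ ⌊(γ : ℝ)⌋₊ := fun h => hγ ⟨⌊(γ : ℝ)⌋₊, Subtype.ext h.symm⟩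
        simp [hW', this]
      · simp only [Function.comp_apply, i, hW', Nat.floor_natCast, if_true, ht, hW, hM,
          Real.Gamma_nat_eq_factorial, Complex.ofReal_natCast, Complex.cpow_natCast, mul_pow]
        ring
    refine (hfrac.add hent).of_eq (fun γ => ?_) ?_
    · simp only [ht]
      ring
    · rw [hchar]
      ring

end forward

theorem theorem2p3 (S : AddSubsemigroup ℝ) (c : ℝ) (hS : IsExponentSet S c)
    (μ : Measure ℝ) [IsProbabilityMeasure μ] :
    MemPS S c μ ↔
      ∃ (m : ℝ → ℂ) (A : ℝ), 0 < A ∧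
        (∀ γ ∈ S, 0 < γ → ‖m γ‖ ≤ A ^ γ) ∧
        m 0 = 1 ∧
        ∀ z : ℝ, 0 < z →
          HasSum
            (fun γ : S => m γ / (Real.Gamma (γ + 1) : ℂ) * Complex.I ^ ((γ : ℝ) : ℂ) *
              (z : ℂ) ^ ((γ : ℝ) : ℂ))
            (charFun μ z) := by
  constructor
  · intro hμ
    obtain ⟨m, A, hA, hm, hF⟩ := hμ.exists_hasSum_charFun hS
    exact ⟨m, A, hA, hm, coeff_zero_eq_one hS hF, hF⟩
  · rintro ⟨m, A, hA, hm, hm0, hF⟩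
    refine memPS_of_hasSum_charFun hS hA (fun γ hγ => ?_) hm0 hF
    -- The bound at γ = 0, absent from the hypothesis, reads ‖m 0‖ = 1 = A^0.
    rcases (hS.nonneg γ hγ).eq_or_lt with h | h
    · simp [← h, hm0]
    · exact hm γ hγ h
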